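/- For integers $k_1,\dots,k_n\ge 1$ with $k_n\ge 2$, let $$\zeta^{\star}(k_1,\dots,k_n)=\sum_{1\le m_1\le\cdots\le m_n<\infty}\frac{1}{m_1^{k_1}\cdots m_n^{k_n}}$$ (a convergent series), let $\{a\}^{n}$ denote $a$ repeated $n$ times ($\{a\}^0$ is empty), let $\delta_{ij}$ be Kronecker's delta, and let $B_n$ be the $n$-th Bernoulli number. Then for every integer $s\ge 1$, $$\zeta^{\star}(4,\{2\}^{s-1})=c(s)\,\zeta^{\star}(\{2\}^{s+1})-\frac{2}{3}\sum_{\substack{k_1+k_2+k_3=s-2\\ k_j\in\mathbb{Z}_{\ge 0}}}(2+\delta_{0k_1})\,\zeta^{\star}(\{2\}^{k_1},3,\{2\}^{k_2},3,\{2\}^{k_3}),$$ where the sum is empty for $s=1$ and $c(s)$ is the rational number $$c(s)=\frac{2s(s+1)}{3}+\frac{2}{3}\sum_{i=2}^{s+1}\binom{2(s+1)}{2i}\frac{B_{2(s+1-i)}B_{2i}}{B_{2(s+1)}}\cdot\frac{1-2^{1-2(s+1-i)}}{1-2^{1-2(s+1)}}.$$ -/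

import Mathlib

open scoped BigOperators

noncomputable section

/-- The index set `1 ≤ m₁ ≤ ⋯ ≤ mₙ` of an `n`-fold multiple zeta-star series. -/
def starIndex (n : ℕ) : Set (Fin n → ℕ) :=
  {m | (∀ i, 1 ≤ m i) ∧ Monotone m}

/-- The summand `1 / (m₁ ^ k₁ ⋯ mₙ ^ kₙ)`, where `k = [k₁, …, kₙ]`. -/
def starTerm (k : List ℕ) (m : Fin k.length → ℕ) : ℝ :=
  ∏ i : Fin k.length, 1 / (m i : ℝ) ^ (k.get i)

/-- Convergence of the series that defines `ζ⋆(k₁, …, kₙ)`. -/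
def ZetaStarConverges (k : List ℕ) : Prop :=
  Summable (fun m : starIndex k.length => starTerm k m)

/-- The multiple zeta-star value
`ζ⋆(k₁, …, kₙ) = ∑_{1 ≤ m₁ ≤ ⋯ ≤ mₙ} 1 / (m₁ ^ k₁ ⋯ mₙ ^ kₙ)`. -/
def zetaStar (k : List ℕ) : ℝ :=
  ∑' m : starIndex k.length, starTerm k m

/-- The argument string `{2}^a, 3, {2}^b, 3, {2}^c`. -/
def twoThree (a b c : ℕ) : List ℕ :=
  List.replicate a 2 ++ [3] ++ List.replicate b 2 ++ [3] ++ List.replicate c 2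

/-- The triples `(k₁, k₂, k₃)` of nonnegative integers with `k₁ + k₂ + k₃ = s - 2`
(there are none if `s < 2`). -/
def triples (s : ℕ) : Finset (ℕ × ℕ × ℕ) :=
  (Finset.range s ×ˢ Finset.range s ×ˢ Finset.range s).filter
    (fun k => k.1 + k.2.1 + k.2.2 + 2 = s)

/-- The rational coefficient `c(s)`, with `bernoulli n` the `n`-th Bernoulli number. -/
def cCoeff (s : ℕ) : ℚ :=
  2 * (s : ℚ) * ((s : ℚ) + 1) / 3 +
    2 / 3 * ∑ i ∈ Finset.Icc 2 (s + 1),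
      ((2 * (s + 1)).choose (2 * i) : ℚ) *
        (bernoulli (2 * (s + 1 - i)) * bernoulli (2 * i) / bernoulli (2 * (s + 1))) *
        ((1 - (2 : ℚ) ^ (1 - 2 * ((s : ℤ) + 1 - (i : ℤ)))) /
          (1 - (2 : ℚ) ^ (1 - 2 * ((s : ℤ) + 1))))

end

/-! Fix 0 < x ≤ 1/16. Let G = ∏_{j ≥ 1} (1 - x/j²)⁻¹ be the generating function of ζ⋆({2}ⁿ), and let
A, T, D be those of ζ⋆(4,{2}ⁿ), of the sums of ζ⋆(3,{2}^b,3,{2}^c), and of the sums of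
ζ⋆({2}^a,3,{2}^b,3,{2}^c). The weight 2 + δ makes x(T + 2D) the generating function of the sum over
triples.

Put c_j = 1/(j(j² - x)) and C = ∑ c_j. Dividing the recursion in the lower summation bound by the
tail products of G makes it telescope, so D/G = ∑_{i ≤ j} c_i c_j and 2D = G(C² + ∑ c_j²)
(`two_mul_twoThreesGF`). The partial fractions of ∏_{j ≤ n} (1 - x/(v+j)²), differentiated twice at
v = 0, give as n → ∞ the relation 3A + 2xT = G(∑ (3j² - x)/(j²(j² - x)²) - 2xC²)
(`three_mul_fourTwosGF_add`). In 3A + 2x(T + 2D) the square C² cancels. What remains is G ∑ (3j² +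
x)/(j²(j² - x)²), with coefficients ∑_{a+b=n} (4b+3) ζ(2b+4) ζ⋆({2}^a).

This convolution is 3c(s) ζ⋆({2}^{s+1}) for s = n + 1 (`three_mul_cCoeff`). With M = s + 1, Euler's
evaluations turn the Bernoulli terms of c(s) into -2ζ(2i) ζ⋆({2}^{M-i})/ζ⋆({2}^M). The polynomial
term comes from `second_order_newton`, which is Newton's identity for G differentiated once more and
simplified by Euler's convolution formula for even zeta values. -/

/-! ### Nested series with values in [0, ∞] -/

open scoped ENNReal in
/-- The nested series `∑_{a ≤ m₁ ≤ ⋯ ≤ mₙ} 1 / (m₁ ^ k₁ ⋯ mₙ ^ kₙ)` with values in `[0, ∞]`. -/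
noncomputable def starTail : List ℕ → ℕ → ℝ≥0∞
  | [], _ => 1
  | k :: ks, a => ∑' i : ℕ, (((a + i : ℕ) : ℝ≥0∞) ^ k)⁻¹ * starTail ks (a + i)

/-- Monotone tuples of natural numbers with entries at least `a`. -/
def monotoneFrom (a n : ℕ) : Set (Fin n → ℕ) :=
  {m | (∀ i, a ≤ m i) ∧ Monotone m}

/-- Splitting off the first entry of a monotone tuple. -/
def monotoneFromSuccEquiv (a n : ℕ) :
    (Σ i : ℕ, monotoneFrom (a + i) n) ≃ monotoneFrom a (n + 1) where
  toFun p := ⟨Fin.cons (a + p.1) p.2.1, by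
    obtain ⟨i, m, h1, h2⟩ := p
    refine ⟨fun j => ?_, fun j k hjk => ?_⟩
    · refine Fin.cases ?_ (fun j => ?_) j
      · simp
      · simpa using (Nat.le_add_right a i).trans (h1 j)
    · induction j using Fin.cases with
      | zero =>
        induction k using Fin.cases with
        | zero => simp
        | succ k => simpa using h1 k
      | succ j =>
        induction k using Fin.cases with
        | zero => exact absurd hjk (by simp)
        | succ k => simpa using h2 (Fin.succ_le_succ_iff.1 hjk)⟩
  invFun m := ⟨m.1 0 - a, ⟨fun j => m.1 j.succ, by
    obtain ⟨m, h1, h2⟩ := m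
    refine ⟨fun j => ?_, fun j k hjk => h2 (Fin.succ_le_succ_iff.2 hjk)⟩
    have := h1 0
    have := h2 (Fin.zero_le j.succ)
    simp only
    omega⟩⟩
  left_inv p := by
    obtain ⟨i, m, h1, h2⟩ := p
    refine Sigma.ext (by simp) ?_
    simp only [Fin.cons_succ]
    congr 1
    · simp
    · exact proof_irrel_heq _ _
  right_inv m := by
    obtain ⟨m, h1, h2⟩ := m
    ext j
    refine Fin.cases ?_ (fun j => ?_) j
    · have := h1 0
      simp only [Fin.cons_zero]
      omega
    · simp

-- Peeling off the smallest entry turns the sum over tuples into an iterated one. Working in [0, ∞]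
-- lets sums be rearranged before any convergence is known.
open scoped ENNReal in
theorem tsum_monotoneFrom (k : List ℕ) (a : ℕ) :
    ∑' m : monotoneFrom a k.length, ∏ i, (((m.1 i : ℕ) : ℝ≥0∞) ^ (k.get i))⁻¹ = starTail k a := by
  induction k generalizing a with
  | nil =>
    have : Unique (monotoneFrom a ([] : List ℕ).length) :=
      { default := ⟨Fin.elim0, fun i => i.elim0, fun i => i.elim0⟩
        uniq := fun m => Subtype.ext (funext fun i => i.elim0) }
    rw [tsum_fintype]
    simp [starTail]
  | cons k ks ih =>
    rw [starTail]
    simp only [List.length_cons]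
    rw [← (monotoneFromSuccEquiv a ks.length).tsum_eq, ENNReal.tsum_sigma']
    refine tsum_congr fun i => ?_
    rw [← ih, ← ENNReal.tsum_mul_left]
    refine tsum_congr fun m => ?_
    rw [Fin.prod_univ_succ]
    simp [monotoneFromSuccEquiv]

theorem starIndex_eq (n : ℕ) : starIndex n = monotoneFrom 1 n := rfl

theorem starTerm_nonneg (k : List ℕ) (m : Fin k.length → ℕ) : 0 ≤ starTerm k m :=
  Finset.prod_nonneg fun _ _ => by positivity

theorem tsum_ofReal_starTerm (k : List ℕ) :
    ∑' m : starIndex k.length, ENNReal.ofReal (starTerm k m) = starTail k 1 := by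
  rw [← tsum_monotoneFrom, starIndex_eq]
  refine tsum_congr fun m => ?_
  rw [starTerm, ENNReal.ofReal_prod_of_nonneg fun _ _ => by positivity]
  refine Finset.prod_congr rfl fun i _ => ?_
  have h : 0 < (m.1 i : ℝ) := by exact_mod_cast m.2.1 i
  rw [one_div, ENNReal.ofReal_inv_of_pos (by positivity), ENNReal.ofReal_pow h.le,
    ENNReal.ofReal_natCast]

theorem zetaStar_eq_toReal (k : List ℕ) : zetaStar k = (starTail k 1).toReal := by
  rw [← tsum_ofReal_starTerm, ENNReal.tsum_toReal_eq fun _ => ENNReal.ofReal_ne_top]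
  exact tsum_congr fun m => (ENNReal.toReal_ofReal (starTerm_nonneg _ _)).symm

theorem zetaStarConverges_of_ne_top {k : List ℕ} (h : starTail k 1 ≠ ⊤) :
    ZetaStarConverges k := by
  rw [← tsum_ofReal_starTerm] at h
  refine (ENNReal.summable_toReal h).congr fun m => ?_
  exact ENNReal.toReal_ofReal (starTerm_nonneg _ _)

theorem tsum_inv_sq_le : ∑' i : ℕ, (((1 + i : ℕ) : ENNReal) ^ 2)⁻¹ ≤ 2 := by
  have h1 : HasSum (fun i : ℕ => 1 / ((1 + i : ℕ) : ℝ) ^ 2) (Real.pi ^ 2 / 6) := by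
    have := (hasSum_nat_add_iff' 1).2 hasSum_zeta_two
    simpa [add_comm] using this
  have h2 : ∀ i : ℕ, (((1 + i : ℕ) : ENNReal) ^ 2)⁻¹
      = ENNReal.ofReal (1 / ((1 + i : ℕ) : ℝ) ^ 2) := fun i => by
    rw [one_div, ENNReal.ofReal_inv_of_pos (by positivity), ENNReal.ofReal_pow (by positivity),
      ENNReal.ofReal_natCast]
  simp_rw [h2]
  rw [← ENNReal.ofReal_tsum_of_nonneg (fun _ => by positivity) h1.summable, h1.tsum_eq]
  have : Real.pi ^ 2 / 6 ≤ 2 := by nlinarith [Real.pi_lt_d2, Real.pi_pos]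
  simpa using ENNReal.ofReal_le_ofReal this

/-- Each layer of summation costs at most ∑ 1/i² = π²/6 ≤ 2. All convergence statements rest on this
bound. -/
theorem starTail_le_two_pow (k : List ℕ) (hk : ∀ j ∈ k, 2 ≤ j) (a : ℕ) (ha : 1 ≤ a) :
    starTail k a ≤ 2 ^ k.length := by
  induction k generalizing a with
  | nil => simp [starTail]
  | cons k ks ih =>
    have hk2 : 2 ≤ k := hk k (by simp)
    rw [starTail, List.length_cons, pow_succ']
    calc _ ≤ ∑' i : ℕ, (((1 + i : ℕ) : ENNReal) ^ 2)⁻¹ * 2 ^ ks.length := by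
          refine ENNReal.tsum_le_tsum fun i => mul_le_mul' ?_
            (ih (fun j hj => hk j (by simp [hj])) _ (by omega))
          rw [ENNReal.inv_le_inv]
          exact_mod_cast (Nat.pow_le_pow_left (by omega : 1 + i ≤ a + i) 2).trans
            (Nat.pow_le_pow_right (by omega) hk2)
      _ ≤ _ := by
          rw [ENNReal.tsum_mul_right]
          exact mul_le_mul' tsum_inv_sq_le le_rfl

theorem starTail_ne_top (k : List ℕ) (hk : ∀ j ∈ k, 2 ≤ j) (a : ℕ) (ha : 1 ≤ a) :
    starTail k a ≠ ⊤ :=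
  ((starTail_le_two_pow k hk a ha).trans_lt (by simp [lt_top_iff_ne_top])).ne

/-! ### Prepending arguments, and generating functions -/

open scoped ENNReal in
/-- The operator `φ ↦ (a ↦ ∑_{m ≥ a} φ m / m ^ k)` prepending an argument `k`. -/
noncomputable def prependArg (k : ℕ) (φ : ℕ → ℝ≥0∞) (a : ℕ) : ℝ≥0∞ :=
  ∑' i : ℕ, (((a + i : ℕ) : ℝ≥0∞) ^ k)⁻¹ * φ (a + i)

theorem starTail_cons (k : ℕ) (ks : List ℕ) : starTail (k :: ks) = prependArg k (starTail ks) := by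
  ext a
  rw [starTail, prependArg]

theorem starTail_replicate_append (n k : ℕ) (ks : List ℕ) :
    starTail (List.replicate n k ++ ks) = (prependArg k)^[n] (starTail ks) := by
  induction n with
  | zero => rfl
  | succ n ih => rw [List.replicate_succ, List.cons_append, starTail_cons, ih,
      Function.iterate_succ_apply']

theorem prependArg_sum {ι : Type*} (s : Finset ι) (k : ℕ) (φ : ι → ℕ → ENNReal) (a : ℕ) :
    prependArg k (fun a => ∑ j ∈ s, φ j a) a = ∑ j ∈ s, prependArg k (φ j) a := by
  simp only [prependArg, Finset.mul_sum]
  exact Summable.tsum_finsetSum fun _ _ => ENNReal.summable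

open scoped ENNReal in
/-- All ways of prepending `p` twos to the members of the sequence `φ`, with total index `n`. -/
noncomputable def insertTwos (φ : ℕ → ℕ → ℝ≥0∞) (n a : ℕ) : ℝ≥0∞ :=
  ∑ p ∈ Finset.HasAntidiagonal.antidiagonal n, ((prependArg 2)^[p.1] (φ p.2)) a

theorem insertTwos_zero (φ : ℕ → ℕ → ENNReal) (a : ℕ) : insertTwos φ 0 a = φ 0 a := by
  simp [insertTwos]

/-- Either no two is prepended, or one of them can be stripped off. -/
theorem insertTwos_succ (φ : ℕ → ℕ → ENNReal) (n a : ℕ) :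
    insertTwos φ (n + 1) a = φ (n + 1) a + prependArg 2 (insertTwos φ n) a := by
  rw [insertTwos, Finset.Nat.sum_antidiagonal_succ]
  simp only [Function.iterate_zero, id, Function.iterate_succ_apply']
  congr 1
  exact (prependArg_sum _ _ _ _).symm

open scoped ENNReal in
/-- The generating function of a sequence in `[0, ∞]`. -/
noncomputable def genFun (c : ℕ → ℝ≥0∞) (x : ℝ≥0∞) : ℝ≥0∞ := ∑' n, c n * x ^ n

theorem genFun_succ (c : ℕ → ENNReal) (x : ENNReal) :
    genFun c x = c 0 + x * genFun (fun n => c (n + 1)) x := by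
  rw [genFun, tsum_eq_zero_add' (M := ENNReal), genFun, ← ENNReal.tsum_mul_left]
  · simp only [pow_zero, mul_one]
    congr 1
    exact tsum_congr fun n => by ring
  · exact ENNReal.summable

theorem genFun_add (c d : ℕ → ENNReal) (x : ENNReal) :
    genFun (fun n => c n + d n) x = genFun c x + genFun d x := by
  simp only [genFun, add_mul]
  exact ENNReal.tsum_add

theorem genFun_prependArg (k : ℕ) (φ : ℕ → ℕ → ENNReal) (x : ENNReal) (a : ℕ) :
    genFun (fun n => prependArg k (φ n) a) x = prependArg k (fun a => genFun (fun n => φ n a) x) a := by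
  simp only [genFun, prependArg, ← ENNReal.tsum_mul_left, ← ENNReal.tsum_mul_right]
  rw [ENNReal.tsum_comm]
  exact tsum_congr fun i => tsum_congr fun n => by ring

theorem genFun_insertTwos (φ : ℕ → ℕ → ENNReal) (x : ENNReal) (a : ℕ) :
    genFun (fun n => insertTwos φ n a) x = genFun (fun n => φ n a) x
      + x * prependArg 2 (fun a => genFun (fun n => insertTwos φ n a) x) a := by
  rw [genFun_succ, ← genFun_prependArg, insertTwos_zero]
  simp only [insertTwos_succ, genFun_add]
  rw [genFun_succ (fun n => φ n a)]
  ring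

/-- The majorant 4 · 8ⁿ serves every sequence below; for x ≤ 1/16 it leaves a geometric series of
ratio 1/2. -/
theorem genFun_le {c : ℕ → ENNReal} (hc : ∀ n, c n ≤ 4 * 8 ^ n) {x : ENNReal} (hx : x ≤ 16⁻¹) :
    genFun c x ≤ 8 := by
  have h : ∀ n, c n * x ^ n ≤ 4 * (2⁻¹ : ENNReal) ^ n := fun n => by
    calc c n * x ^ n ≤ 4 * 8 ^ n * (16⁻¹) ^ n :=
          mul_le_mul' (hc n) (pow_le_pow_left₀ (by simp) hx n)
      _ = 4 * (2⁻¹ : ENNReal) ^ n := by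
          rw [mul_assoc, ← mul_pow]
          congr 2
          rw [show (16 : ENNReal) = 8 * 2 by norm_num,
            ENNReal.mul_inv (by simp) (by simp), ← mul_assoc,
            ENNReal.mul_inv_cancel (by simp) (by simp), one_mul]
  refine (ENNReal.tsum_le_tsum h).trans ?_
  rw [ENNReal.tsum_mul_left, ENNReal.tsum_geometric, ENNReal.one_sub_inv_two, inv_inv]
  norm_num

/-- Through this splitting, a fixed-point equation involving `prependArg` becomes a first-order
recursion in the lower bound a; `tendsto_prependArg` supplies its boundary value at infinity. -/
theorem prependArg_succ (k : ℕ) (φ : ℕ → ENNReal) (a : ℕ) :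
    prependArg k φ a = ((a : ENNReal) ^ k)⁻¹ * φ a + prependArg k φ (a + 1) := by
  rw [prependArg, tsum_eq_zero_add' (M := ENNReal), prependArg]
  · simp only [add_zero]
    congr 1
    exact tsum_congr fun i => by rw [show a + (i + 1) = a + 1 + i by ring]
  · exact ENNReal.summable

theorem tendsto_prependArg {k : ℕ} {φ : ℕ → ENNReal} (h : prependArg k φ 1 ≠ ⊤) :
    Filter.Tendsto (prependArg k φ) Filter.atTop (nhds 0) := by
  have := ENNReal.tendsto_sum_nat_add (fun i => (((1 + i : ℕ) : ENNReal) ^ k)⁻¹ * φ (1 + i)) h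
  rw [← Filter.tendsto_add_atTop_iff_nat 1]
  refine this.congr fun i => ?_
  rw [prependArg]
  exact tsum_congr fun j => by rw [show i + 1 + j = 1 + (j + i) by ring]

/-! ### Strings of twos containing no, one or two threes -/

/-- The sequence of the tails of `ζ⋆({2}ⁿ)`. -/
noncomputable def twos (n : ℕ) : ℕ → ENNReal := starTail (List.replicate n 2)

/-- The tails of the sums of all `ζ⋆({2}^b, 3, {2}^c)` with `b + c = n`. -/
noncomputable def oneThree : ℕ → ℕ → ENNReal := insertTwos fun n => prependArg 3 (twos n)

/-- The tails of the sums of all `ζ⋆({2}^a, 3, {2}^b, 3, {2}^c)` with `a + b + c = n`. -/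
noncomputable def twoThrees : ℕ → ℕ → ENNReal := insertTwos fun n => prependArg 3 (oneThree n)

theorem twos_zero (a : ℕ) : twos 0 a = 1 := rfl

theorem twos_succ (n : ℕ) : twos (n + 1) = prependArg 2 (twos n) := starTail_cons _ _

theorem oneThree_eq (n a : ℕ) : oneThree n a =
    ∑ p ∈ Finset.HasAntidiagonal.antidiagonal n,
      starTail (List.replicate p.1 2 ++ 3 :: List.replicate p.2 2) a := by
  rw [oneThree, insertTwos]
  refine Finset.sum_congr rfl fun p _ => ?_
  rw [starTail_replicate_append, starTail_cons]
  rfl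

theorem prependArg_oneThree (n a : ℕ) : prependArg 3 (oneThree n) a =
    ∑ p ∈ Finset.HasAntidiagonal.antidiagonal n, starTail (twoThree 0 p.1 p.2) a := by
  rw [show oneThree n = fun a => _ from funext (oneThree_eq n), prependArg_sum]
  refine Finset.sum_congr rfl fun p _ => ?_
  rw [← starTail_cons]
  simp [twoThree]

theorem iterate_prependArg_sum {ι : Type*} (s : Finset ι) (k n : ℕ) (φ : ι → ℕ → ENNReal) :
    (prependArg k)^[n] (fun a => ∑ j ∈ s, φ j a) =
      fun a => ∑ j ∈ s, (prependArg k)^[n] (φ j) a := by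
  induction n with
  | zero => rfl
  | succ n ih =>
    rw [Function.iterate_succ_apply', ih]
    ext a
    rw [prependArg_sum]
    simp only [Function.iterate_succ_apply']

theorem twoThrees_eq (n a : ℕ) : twoThrees n a =
    ∑ p ∈ Finset.HasAntidiagonal.antidiagonal n, ∑ q ∈ Finset.HasAntidiagonal.antidiagonal p.2,
      starTail (twoThree p.1 q.1 q.2) a := by
  rw [twoThrees, insertTwos]
  refine Finset.sum_congr rfl fun p _ => ?_
  rw [show prependArg 3 (oneThree p.2) = fun a => _ from funext (prependArg_oneThree p.2),
    iterate_prependArg_sum]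
  refine Finset.sum_congr rfl fun q _ => ?_
  rw [← starTail_replicate_append]
  simp [twoThree]

theorem twos_le (n a : ℕ) (ha : 1 ≤ a) : twos n a ≤ 2 ^ n := by
  have := starTail_le_two_pow (List.replicate n 2)
    (fun j hj => (List.eq_of_mem_replicate hj).ge) a ha
  rwa [List.length_replicate] at this

theorem natCast_succ_le_two_pow (n : ℕ) : ((n + 1 : ℕ) : ENNReal) ≤ 2 ^ n := by
  exact_mod_cast Nat.lt_two_pow_self

theorem two_le_of_mem_twoThree {a b c j : ℕ} (hj : j ∈ twoThree a b c) : 2 ≤ j := by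
  simp only [twoThree, List.mem_append, List.mem_replicate, List.mem_singleton] at hj
  omega

theorem oneThree_le (n a : ℕ) (ha : 1 ≤ a) : oneThree n a ≤ 4 * 8 ^ n := by
  rw [oneThree_eq]
  have h : ∀ p ∈ Finset.HasAntidiagonal.antidiagonal n,
      starTail (List.replicate p.1 2 ++ 3 :: List.replicate p.2 2) a ≤ 2 ^ (n + 1) := by
    intro p hp
    have := starTail_le_two_pow (List.replicate p.1 2 ++ 3 :: List.replicate p.2 2)
      (fun j hj => by
        simp only [List.mem_append, List.mem_replicate, List.mem_cons] at hj
        omega) a ha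
    rw [Finset.HasAntidiagonal.mem_antidiagonal] at hp
    rwa [List.length_append, List.length_cons, List.length_replicate, List.length_replicate,
      ← add_assoc, hp] at this
  refine (Finset.sum_le_card_nsmul _ _ _ h).trans ?_
  rw [Finset.Nat.card_antidiagonal, nsmul_eq_mul]
  refine (mul_le_mul_left (natCast_succ_le_two_pow n) _).trans ?_
  norm_cast
  rw [show 8 = 2 ^ 3 by norm_num, show 4 = 2 ^ 2 by norm_num, ← pow_mul, ← pow_add, ← pow_add]
  exact Nat.pow_le_pow_right (by norm_num) (by omega)

theorem twoThrees_le (n a : ℕ) (ha : 1 ≤ a) : twoThrees n a ≤ 4 * 8 ^ n := by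
  rw [twoThrees_eq]
  have h : ∀ p ∈ Finset.HasAntidiagonal.antidiagonal n, ∑ q ∈ Finset.HasAntidiagonal.antidiagonal p.2,
      starTail (twoThree p.1 q.1 q.2) a ≤ 2 ^ n * 2 ^ (n + 2) := by
    intro p hp
    rw [Finset.HasAntidiagonal.mem_antidiagonal] at hp
    have h2 : ∀ q ∈ Finset.HasAntidiagonal.antidiagonal p.2,
        starTail (twoThree p.1 q.1 q.2) a ≤ 2 ^ (n + 2) := by
      intro q hq
      rw [Finset.HasAntidiagonal.mem_antidiagonal] at hq
      have := starTail_le_two_pow (twoThree p.1 q.1 q.2) (fun j => two_le_of_mem_twoThree) a ha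
      have hl : (twoThree p.1 q.1 q.2).length = n + 2 := by
        simp [twoThree]
        omega
      rwa [hl] at this
    refine (Finset.sum_le_card_nsmul _ _ _ h2).trans ?_
    rw [Finset.Nat.card_antidiagonal, nsmul_eq_mul]
    refine mul_le_mul_left ((natCast_succ_le_two_pow _).trans ?_) _
    exact_mod_cast Nat.pow_le_pow_right (by norm_num : 0 < 2) (by omega : p.2 ≤ n)
  refine (Finset.sum_le_card_nsmul _ _ _ h).trans ?_
  rw [Finset.Nat.card_antidiagonal, nsmul_eq_mul]
  refine (mul_le_mul_left (natCast_succ_le_two_pow n) _).trans ?_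
  norm_cast
  rw [show 8 = 2 ^ 3 by norm_num, show 4 = 2 ^ 2 by norm_num, ← pow_mul, ← pow_add, ← pow_add,
    ← pow_add]
  exact Nat.pow_le_pow_right (by norm_num) (by omega)

theorem natCast_mul_twos_le (n a : ℕ) (ha : 1 ≤ a) : n * twos n a ≤ 4 * 8 ^ n := by
  refine (mul_le_mul' ((Nat.cast_le.2 n.le_succ).trans (natCast_succ_le_two_pow n))
    (twos_le n a ha)).trans ?_
  norm_cast
  rw [show 8 = 2 ^ 3 by norm_num, show 4 = 2 ^ 2 by norm_num, ← pow_mul, ← pow_add, ← pow_add]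
  exact Nat.pow_le_pow_right (by norm_num) (by omega)

theorem genFun_twos (x : ENNReal) (a : ℕ) :
    genFun (fun n => twos n a) x = 1 + x * prependArg 2 (fun a => genFun (fun n => twos n a) x) a := by
  rw [genFun_succ, ← genFun_prependArg, twos_zero]
  simp only [twos_succ]

/-- This is x d/dx applied to `genFun_twos`, done on coefficients by writing n + 1 as 1 + n. -/
theorem genFun_natCast_mul_twos (x : ENNReal) (a : ℕ) :
    genFun (fun n => n * twos n a) x =
      x * prependArg 2 (fun a => genFun (fun n => twos n a) x
        + genFun (fun n => n * twos n a) x) a := by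
  rw [genFun_succ]
  simp only [← genFun_add]
  rw [← genFun_prependArg 2 (fun n a => twos n a + n * twos n a)]
  simp only [Nat.cast_zero, zero_mul, zero_add, twos_succ]
  congr 2
  ext n
  simp only [prependArg]
  rw [← ENNReal.tsum_mul_left]
  refine tsum_congr fun i => ?_
  push_cast
  ring

/-! ### Recursions in the lower summation bound -/

theorem toReal_succ_of_eq_add {F E : ℕ → ENNReal} {x : ℝ} (hx : 0 ≤ x) {a : ℕ} (hF : F a ≠ ⊤)
    (h : F a = E a + ENNReal.ofReal x * (((a : ENNReal) ^ 2)⁻¹ * F a) + F (a + 1)) :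
    (F (a + 1)).toReal = (1 - x / (a : ℝ) ^ 2) * (F a).toReal - (E a).toReal := by
  have h0 := hF
  rw [h, ENNReal.add_ne_top, ENNReal.add_ne_top] at h0
  have h1 := congrArg ENNReal.toReal h
  rw [ENNReal.toReal_add (ENNReal.add_ne_top.2 h0.1) h0.2, ENNReal.toReal_add h0.1.1 h0.1.2,
    ENNReal.toReal_mul, ENNReal.toReal_mul, ENNReal.toReal_ofReal hx, ENNReal.toReal_inv,
    ENNReal.toReal_pow, ENNReal.toReal_natCast] at h1
  rw [div_eq_mul_inv]
  linarith

/-- If `F (a + 1) = (1 - x / a²) F a - c a` and `G` solves the homogeneous recursion, then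
`F / G` is the tail of a series. -/
theorem hasSum_of_recursion {F G c : ℕ → ℝ} {x : ℝ} (hc : ∀ a, 1 ≤ a → 0 ≤ c a)
    (hG0 : ∀ a, 1 ≤ a → 0 < G a)
    (hG : ∀ a, 1 ≤ a → G (a + 1) = (1 - x / (a : ℝ) ^ 2) * G a)
    (hGl : Filter.Tendsto G Filter.atTop (nhds 1))
    (hF : ∀ a, 1 ≤ a → F (a + 1) = (1 - x / (a : ℝ) ^ 2) * F a - c a)
    (hFl : Filter.Tendsto F Filter.atTop (nhds 0)) (a : ℕ) (ha : 1 ≤ a) :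
    HasSum (fun i => c (a + i) / G (a + i + 1)) (F a / G a) := by
  rw [hasSum_iff_tendsto_nat_of_nonneg
    (fun i => div_nonneg (hc _ (by omega)) (hG0 _ (by omega)).le)]
  -- Variation of constants: after division by G the recursion telescopes, and F/G → 0/1 at
  -- infinity.
  have h1 : ∀ i, c (a + i) / G (a + i + 1) = F (a + i) / G (a + i) - F (a + i + 1) / G (a + i + 1) := by
    intro i
    have e1 := hG (a + i) (by omega)
    have e2 := hF (a + i) (by omega)
    have p1 := hG0 (a + i) (by omega)
    have p2 := hG0 (a + i + 1) (by omega)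
    have : F (a + i) / G (a + i) = (1 - x / ((a + i : ℕ) : ℝ) ^ 2) * F (a + i) / G (a + i + 1) := by
      rw [div_eq_div_iff p1.ne' p2.ne', e1]
      ring
    rw [this, e2]
    ring
  have h2 : ∀ n, ∑ i ∈ Finset.range n, c (a + i) / G (a + i + 1)
      = F a / G a - F (a + n) / G (a + n) := by
    intro n
    induction n with
    | zero => simp
    | succ n ih =>
      rw [Finset.sum_range_succ, ih, h1, ← add_assoc]
      ring
  simp only [h2]
  have h3 : Filter.Tendsto (fun n => F n / G n) Filter.atTop (nhds 0) := by
    have := hFl.div hGl one_ne_zero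
    rwa [zero_div] at this
  have h4 : Filter.Tendsto (fun n => F (a + n) / G (a + n)) Filter.atTop (nhds 0) := by
    refine (h3.comp (Filter.tendsto_add_atTop_nat a)).congr fun n => ?_
    simp [add_comm]
  simpa using tendsto_const_nhds.sub h4

theorem hasSum_toReal_genFun {c : ℕ → ENNReal} {x : ℝ} (hx : 0 ≤ x)
    (h : genFun c (ENNReal.ofReal x) ≠ ⊤) :
    HasSum (fun n => (c n).toReal * x ^ n) (genFun c (ENNReal.ofReal x)).toReal := by
  have := ENNReal.hasSum_toReal h
  rw [← ENNReal.tsum_toReal_eq fun n => ENNReal.ne_top_of_tsum_ne_top h n] at this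
  simp only [ENNReal.toReal_mul, ENNReal.toReal_pow, ENNReal.toReal_ofReal hx] at this
  exact this

theorem hasSum_toReal_prependArg {k a : ℕ} {φ : ℕ → ENNReal} (h : prependArg k φ a ≠ ⊤) :
    HasSum (fun i : ℕ => (φ (a + i)).toReal / ((a + i : ℕ) : ℝ) ^ k) (prependArg k φ a).toReal := by
  have := ENNReal.hasSum_toReal h
  rw [← ENNReal.tsum_toReal_eq fun n => ENNReal.ne_top_of_tsum_ne_top h n] at this
  simp only [ENNReal.toReal_mul, ENNReal.toReal_inv, ENNReal.toReal_pow,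
    ENNReal.toReal_natCast] at this
  simp only [div_eq_inv_mul]
  exact this

/-- The product `∏_{j ≥ a} (1 - x / j²)⁻¹`, as the generating function of the tails
of `ζ⋆({2}ⁿ)`. -/
noncomputable def twosGF (x : ℝ) (a : ℕ) : ℝ :=
  (genFun (fun n => twos n a) (ENNReal.ofReal x)).toReal

/-- The generating function of `oneThree`. -/
noncomputable def oneThreeGF (x : ℝ) (a : ℕ) : ℝ :=
  (genFun (fun n => oneThree n a) (ENNReal.ofReal x)).toReal

/-- The generating function of `twoThrees`. -/
noncomputable def twoThreesGF (x : ℝ) (a : ℕ) : ℝ :=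
  (genFun (fun n => twoThrees n a) (ENNReal.ofReal x)).toReal

/-- The generating function of `n ζ⋆({2}ⁿ)`. -/
noncomputable def weightedTwosGF (x : ℝ) (a : ℕ) : ℝ :=
  (genFun (fun n => n * twos n a) (ENNReal.ofReal x)).toReal

section

variable {x : ℝ}

theorem ofReal_le_inv_sixteen (hx : x ≤ 1 / 16) : ENNReal.ofReal x ≤ 16⁻¹ := by
  refine (ENNReal.ofReal_le_ofReal hx).trans_eq ?_
  rw [one_div, ENNReal.ofReal_inv_of_pos (by norm_num)]
  simp

theorem genFun_ne_top {c : ℕ → ENNReal} (hc : ∀ n, c n ≤ 4 * 8 ^ n) (hx : x ≤ 1 / 16) :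
    genFun c (ENNReal.ofReal x) ≠ ⊤ :=
  ((genFun_le hc (ofReal_le_inv_sixteen hx)).trans_lt (by simp)).ne

theorem twos_le' (n a : ℕ) (ha : 1 ≤ a) : twos n a ≤ 4 * 8 ^ n := by
  refine (twos_le n a ha).trans ?_
  norm_cast
  exact (Nat.pow_le_pow_left (by norm_num) n).trans (Nat.le_mul_of_pos_left _ (by norm_num))

theorem genFun_twos_ne_top (hx : x ≤ 1 / 16) {a : ℕ} (ha : 1 ≤ a) :
    genFun (fun n => twos n a) (ENNReal.ofReal x) ≠ ⊤ :=
  genFun_ne_top (fun n => twos_le' n a ha) hx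

theorem genFun_oneThree_ne_top (hx : x ≤ 1 / 16) {a : ℕ} (ha : 1 ≤ a) :
    genFun (fun n => oneThree n a) (ENNReal.ofReal x) ≠ ⊤ :=
  genFun_ne_top (fun n => oneThree_le n a ha) hx

theorem genFun_twoThrees_ne_top (hx : x ≤ 1 / 16) {a : ℕ} (ha : 1 ≤ a) :
    genFun (fun n => twoThrees n a) (ENNReal.ofReal x) ≠ ⊤ :=
  genFun_ne_top (fun n => twoThrees_le n a ha) hx

theorem genFun_weightedTwos_ne_top (hx : x ≤ 1 / 16) {a : ℕ} (ha : 1 ≤ a) :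
    genFun (fun n => n * twos n a) (ENNReal.ofReal x) ≠ ⊤ :=
  genFun_ne_top (fun n => natCast_mul_twos_le n a ha) hx

theorem prependArg_ne_top_of_mul {φ : ℕ → ENNReal} {k a : ℕ} (hx0 : 0 < x)
    (h : ENNReal.ofReal x * prependArg k φ a ≠ ⊤) : prependArg k φ a ≠ ⊤ := by
  intro h'
  rw [h', ENNReal.mul_top (by simpa using hx0)] at h
  exact h rfl

theorem twosGF_succ (hx0 : 0 < x) (hx : x ≤ 1 / 16) (a : ℕ) (ha : 1 ≤ a) :
    twosGF x (a + 1) = (1 - x / (a : ℝ) ^ 2) * twosGF x a := by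
  have := toReal_succ_of_eq_add (F := fun a => genFun (fun n => twos n a) (ENNReal.ofReal x))
    (E := fun _ => 0) hx0.le (genFun_twos_ne_top hx ha) (by
      rw [genFun_twos _ (a + 1)]
      conv_lhs => rw [genFun_twos, prependArg_succ]
      ring)
  rwa [ENNReal.toReal_zero, sub_zero] at this

theorem one_le_twosGF (hx : x ≤ 1 / 16) (a : ℕ) (ha : 1 ≤ a) : 1 ≤ twosGF x a := by
  have h := genFun_twos_ne_top hx ha
  rw [twosGF, ← ENNReal.toReal_one]
  refine ENNReal.toReal_mono h ?_
  rw [genFun_twos]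
  exact le_self_add

theorem tendsto_mul_prependArg {φ : ℕ → ENNReal} {k : ℕ} (hx0 : 0 < x)
    (h : ENNReal.ofReal x * prependArg k φ 1 ≠ ⊤) :
    Filter.Tendsto (fun a => ENNReal.ofReal x * prependArg k φ a) Filter.atTop (nhds 0) := by
  have := ENNReal.Tendsto.const_mul (tendsto_prependArg (prependArg_ne_top_of_mul hx0 h))
    (Or.inr (ENNReal.ofReal_ne_top (r := x)))
  simpa using this

theorem tendsto_twosGF (hx0 : 0 < x) (hx : x ≤ 1 / 16) :
    Filter.Tendsto (twosGF x) Filter.atTop (nhds 1) := by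
  have h := genFun_twos_ne_top hx le_rfl
  rw [genFun_twos, ENNReal.add_ne_top] at h
  have h1 := (tendsto_mul_prependArg hx0 h.2).const_add 1
  rw [add_zero] at h1
  have := (ENNReal.tendsto_toReal ENNReal.one_ne_top).comp h1
  rw [ENNReal.toReal_one] at this
  refine this.congr fun a => ?_
  rw [twosGF, genFun_twos]
  rfl

/-- The generating function of `insertTwos φ` divided by that of the tails of `ζ⋆({2}ⁿ)`. -/
theorem hasSum_insertTwos (hx0 : 0 < x) (hx : x ≤ 1 / 16) (k : ℕ) (φ : ℕ → ℕ → ENNReal)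
    (h : ∀ a, 1 ≤ a →
      genFun (fun n => insertTwos (fun n => prependArg k (φ n)) n a) (ENNReal.ofReal x) ≠ ⊤)
    (a : ℕ) (ha : 1 ≤ a) :
    HasSum (fun i : ℕ => (genFun (fun n => φ n (a + i)) (ENNReal.ofReal x)).toReal
        / ((a + i : ℕ) : ℝ) ^ k / twosGF x (a + i + 1))
      ((genFun (fun n => insertTwos (fun n => prependArg k (φ n)) n a)
        (ENNReal.ofReal x)).toReal / twosGF x a) := by
  have key : ∀ a, genFun (fun n => insertTwos (fun n => prependArg k (φ n)) n a) (ENNReal.ofReal x)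
      = prependArg k (fun a => genFun (fun n => φ n a) (ENNReal.ofReal x)) a
        + ENNReal.ofReal x * prependArg 2 (fun a => genFun
          (fun n => insertTwos (fun n => prependArg k (φ n)) n a) (ENNReal.ofReal x)) a := by
    intro a
    rw [genFun_insertTwos, genFun_prependArg]
  refine hasSum_of_recursion (c := fun a => (genFun (fun n => φ n a) (ENNReal.ofReal x)).toReal
    / (a : ℝ) ^ k) (x := x) (F := fun a => (genFun (fun n =>
      insertTwos (fun n => prependArg k (φ n)) n a) (ENNReal.ofReal x)).toReal)
    (fun a _ => by positivity)
    (fun a ha => zero_lt_one.trans_le (one_le_twosGF hx a ha)) (twosGF_succ hx0 hx)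
    (tendsto_twosGF hx0 hx) (fun a ha => ?_) ?_ a ha
  · have := toReal_succ_of_eq_add (F := fun a => genFun
        (fun n => insertTwos (fun n => prependArg k (φ n)) n a) (ENNReal.ofReal x))
      (E := fun a => ((a : ENNReal) ^ k)⁻¹ * genFun (fun n => φ n a) (ENNReal.ofReal x))
      hx0.le (h a ha) (by
        rw [key (a + 1)]
        conv_lhs => rw [key, prependArg_succ, prependArg_succ 2]
        ring)
    rw [this, ENNReal.toReal_mul, ENNReal.toReal_inv, ENNReal.toReal_pow, ENNReal.toReal_natCast]
    ring
  · have h1 := h 1 le_rfl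
    rw [key, ENNReal.add_ne_top] at h1
    have h2 := (tendsto_prependArg h1.1).add (tendsto_mul_prependArg hx0 h1.2)
    rw [add_zero] at h2
    have := (ENNReal.tendsto_toReal ENNReal.zero_ne_top).comp h2
    rw [ENNReal.toReal_zero] at this
    refine this.congr fun a => ?_
    simp only [Function.comp]
    rw [← key]

theorem hasSum_weightedTwosGF (hx0 : 0 < x) (hx : x ≤ 1 / 16) :
    HasSum (fun i : ℕ => x * twosGF x (1 + i) / ((1 + i : ℕ) : ℝ) ^ 2 / twosGF x (1 + i + 1))
      (weightedTwosGF x 1 / twosGF x 1) := by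
  refine hasSum_of_recursion (c := fun a => x * twosGF x a / (a : ℝ) ^ 2) (x := x)
    (F := weightedTwosGF x)
    (fun a ha => ?_)
    (fun a ha => zero_lt_one.trans_le (one_le_twosGF hx a ha)) (twosGF_succ hx0 hx)
    (tendsto_twosGF hx0 hx) (fun a ha => ?_) ?_ 1 le_rfl
  · have := one_le_twosGF hx a ha
    positivity
  · have := toReal_succ_of_eq_add
      (F := fun a => genFun (fun n => n * twos n a) (ENNReal.ofReal x))
      (E := fun a => ENNReal.ofReal x * (((a : ENNReal) ^ 2)⁻¹ *
        genFun (fun n => twos n a) (ENNReal.ofReal x)))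
      hx0.le (genFun_weightedTwos_ne_top hx ha) (by
        rw [genFun_natCast_mul_twos _ (a + 1)]
        conv_lhs => rw [genFun_natCast_mul_twos, prependArg_succ]
        ring)
    rw [weightedTwosGF, this, ENNReal.toReal_mul, ENNReal.toReal_mul, ENNReal.toReal_inv,
      ENNReal.toReal_pow, ENNReal.toReal_natCast, ENNReal.toReal_ofReal hx0.le, weightedTwosGF,
      twosGF]
    ring
  · have h1 := genFun_weightedTwos_ne_top hx le_rfl
    rw [genFun_natCast_mul_twos] at h1
    have := (ENNReal.tendsto_toReal ENNReal.zero_ne_top).comp (tendsto_mul_prependArg hx0 h1)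
    rw [ENNReal.toReal_zero] at this
    refine this.congr fun a => ?_
    simp only [Function.comp]
    rw [weightedTwosGF, ← genFun_natCast_mul_twos]

end

/-! ### Each three contributes a sum of 1 / (m (m² - x)) -/

/-- The summand `1 / (m (m² - x))`. -/
noncomputable def cubicTerm (x : ℝ) (m : ℕ) : ℝ := 1 / (m * ((m : ℝ) ^ 2 - x))

/-- The tail `∑_{m ≥ a} 1 / (m (m² - x))`. -/
noncomputable def cubicTail (x : ℝ) (a : ℕ) : ℝ := ∑' i, cubicTerm x (a + i)

section

variable {x : ℝ}

theorem one_le_sq_cast {m : ℕ} (hm : 1 ≤ m) : (1 : ℝ) ≤ (m : ℝ) ^ 2 := by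
  have : (1 : ℝ) ≤ m := by exact_mod_cast hm
  nlinarith

theorem cubicTerm_pos (hx : x ≤ 1 / 16) {m : ℕ} (hm : 1 ≤ m) : 0 < cubicTerm x m := by
  have h1 := one_le_sq_cast hm
  have h2 : (0 : ℝ) < m := by exact_mod_cast hm
  exact one_div_pos.2 (mul_pos h2 (by linarith))

/-- One factor of the product separates consecutive tails: their quotient is m²/(m² - x). -/
theorem twosGF_div_succ (hx0 : 0 < x) (hx : x ≤ 1 / 16) {m : ℕ} (hm : 1 ≤ m) :
    twosGF x m / (m : ℝ) ^ 3 / twosGF x (m + 1) = cubicTerm x m := by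
  have h0 := one_le_twosGF hx m hm
  have h1 := one_le_sq_cast hm
  have h2 : (0 : ℝ) < m := by exact_mod_cast hm
  have h3 : (m : ℝ) ^ 2 - x ≠ 0 := by linarith
  rw [twosGF_succ hx0 hx m hm, cubicTerm]
  have h4 : (1 - x / (m : ℝ) ^ 2) = ((m : ℝ) ^ 2 - x) / (m : ℝ) ^ 2 := by
    field_simp
  have h5 : twosGF x m ≠ 0 := by linarith
  rw [h4]
  field_simp

theorem hasSum_cubicTerm (hx0 : 0 < x) (hx : x ≤ 1 / 16) {a : ℕ} (ha : 1 ≤ a) :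
    HasSum (fun i => cubicTerm x (a + i)) (oneThreeGF x a / twosGF x a) := by
  have h := hasSum_insertTwos hx0 hx 3 twos (fun a ha => genFun_oneThree_ne_top hx ha) a ha
  convert h using 1
  swap
  · rfl
  ext i
  exact (twosGF_div_succ hx0 hx (by omega)).symm

theorem oneThreeGF_eq (hx0 : 0 < x) (hx : x ≤ 1 / 16) {a : ℕ} (ha : 1 ≤ a) :
    oneThreeGF x a = twosGF x a * cubicTail x a := by
  have h := one_le_twosGF hx a ha
  rw [cubicTail, (hasSum_cubicTerm hx0 hx ha).tsum_eq]
  field_simp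

theorem hasSum_cubicTail (hx0 : 0 < x) (hx : x ≤ 1 / 16) {a : ℕ} (ha : 1 ≤ a) :
    HasSum (fun i => cubicTerm x (a + i)) (cubicTail x a) :=
  (hasSum_cubicTerm hx0 hx ha).summable.hasSum

theorem cubicTail_succ (hx0 : 0 < x) (hx : x ≤ 1 / 16) {a : ℕ} (ha : 1 ≤ a) :
    cubicTail x a = cubicTerm x a + cubicTail x (a + 1) := by
  rw [cubicTail, (hasSum_cubicTail hx0 hx ha).summable.tsum_eq_zero_add, cubicTail]
  simp only [add_zero]
  congr 1
  exact tsum_congr fun i => by rw [show a + (i + 1) = a + 1 + i by ring]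

theorem cubicTail_nonneg (hx : x ≤ 1 / 16) {a : ℕ} (ha : 1 ≤ a) : 0 ≤ cubicTail x a :=
  tsum_nonneg fun i => (cubicTerm_pos hx (by omega)).le

theorem tendsto_cubicTail : Filter.Tendsto (cubicTail x) Filter.atTop (nhds 0) := by
  refine (tendsto_sum_nat_add (cubicTerm x)).congr fun a => ?_
  exact tsum_congr fun i => by rw [add_comm]

/-- `hasSum_insertTwos` is applied a second time, now to `oneThree`, whose generating function is
the tail product times `cubicTail`. -/
theorem hasSum_twoThreesGF (hx0 : 0 < x) (hx : x ≤ 1 / 16) :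
    HasSum (fun i => cubicTerm x (1 + i) * cubicTail x (1 + i))
      (twoThreesGF x 1 / twosGF x 1) := by
  have h := hasSum_insertTwos hx0 hx 3 oneThree (fun a ha => genFun_twoThrees_ne_top hx ha) 1 le_rfl
  convert h using 1
  swap
  · rfl
  ext i
  rw [← twosGF_div_succ hx0 hx (by omega : 1 ≤ 1 + i)]
  have : (genFun (fun n => oneThree n (1 + i)) (ENNReal.ofReal x)).toReal = oneThreeGF x (1 + i) :=
    rfl
  rw [this, oneThreeGF_eq hx0 hx (by omega)]
  ring

theorem summable_cubicTerm_sq (hx0 : 0 < x) (hx : x ≤ 1 / 16) :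
    Summable fun i => cubicTerm x (1 + i) ^ 2 := by
  refine Summable.of_nonneg_of_le (fun i => sq_nonneg _) (fun i => ?_)
    (hasSum_twoThreesGF hx0 hx).summable
  have h1 := cubicTerm_pos hx (by omega : 1 ≤ 1 + i)
  have h2 := cubicTail_nonneg hx (by omega : 1 ≤ 1 + i + 1)
  rw [cubicTail_succ hx0 hx (by omega : 1 ≤ 1 + i), sq]
  exact mul_le_mul_of_nonneg_left (by linarith) h1.le

/-- This is 2 ∑_{i ≤ j} c_i c_j = (∑ c_i)² + ∑ c_i², obtained by telescoping the squares of the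
tails. -/
theorem two_mul_twoThreesGF (hx0 : 0 < x) (hx : x ≤ 1 / 16) :
    2 * twoThreesGF x 1 =
      twosGF x 1 * (cubicTail x 1 ^ 2 + ∑' i, cubicTerm x (1 + i) ^ 2) := by
  have h1 := (hasSum_twoThreesGF hx0 hx).mul_left 2
  have h2 := h1.sub (summable_cubicTerm_sq hx0 hx).hasSum
  have h3 : ∀ n, ∑ i ∈ Finset.range n, (2 * (cubicTerm x (1 + i) * cubicTail x (1 + i))
      - cubicTerm x (1 + i) ^ 2) = cubicTail x 1 ^ 2 - cubicTail x (1 + n) ^ 2 := by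
    intro n
    induction n with
    | zero => simp
    | succ n ih =>
      rw [Finset.sum_range_succ, ih, cubicTail_succ hx0 hx (by omega : 1 ≤ 1 + n), ← add_assoc]
      ring
  have h4 := h2.tendsto_sum_nat
  simp only [h3] at h4
  have h5 : Filter.Tendsto (fun n => cubicTail x 1 ^ 2 - cubicTail x (1 + n) ^ 2) Filter.atTop
      (nhds (cubicTail x 1 ^ 2 - 0 ^ 2)) := by
    refine tendsto_const_nhds.sub (Filter.Tendsto.pow ?_ 2)
    refine ((tendsto_cubicTail (x := x)).comp (Filter.tendsto_add_atTop_nat 1)).congr fun n => ?_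
    simp [add_comm]
  have h6 := tendsto_nhds_unique h4 h5
  have h7 := one_le_twosGF hx 1 le_rfl
  have h8 : twoThreesGF x 1 / twosGF x 1 * twosGF x 1 = twoThreesGF x 1 := by
    field_simp
  linear_combination twosGF x 1 * h6 - 2 * h8

/-- The quotient is x d/dx log ∏ (1 - x/j²)⁻¹, here without differentiating an infinite product. -/
theorem hasSum_weightedTwosGF_div (hx0 : 0 < x) (hx : x ≤ 1 / 16) :
    HasSum (fun i : ℕ => x / (((1 + i : ℕ) : ℝ) ^ 2 - x)) (weightedTwosGF x 1 / twosGF x 1) := by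
  convert hasSum_weightedTwosGF hx0 hx using 1
  ext i
  have h := twosGF_div_succ hx0 hx (by omega : 1 ≤ 1 + i)
  have h0 : ((1 + i : ℕ) : ℝ) ≠ 0 := by positivity
  have h2 := one_le_sq_cast (by omega : 1 ≤ 1 + i)
  have h3 : ((1 + i : ℕ) : ℝ) ^ 2 - x ≠ 0 := by linarith
  calc _ = x * ((1 + i : ℕ) : ℝ) * cubicTerm x (1 + i) := by
        rw [cubicTerm]
        field_simp
    _ = _ := by
        rw [← h]
        have := one_le_twosGF hx (1 + i + 1) (by omega)
        have : twosGF x (1 + i + 1) ≠ 0 := by linarith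
        field_simp

/-- The generating function of `ζ⋆(4, {2}ⁿ)`. -/
noncomputable def fourTwosGF (x : ℝ) : ℝ :=
  (genFun (fun n => prependArg 4 (twos n) 1) (ENNReal.ofReal x)).toReal

/-- The generating function of the sums of all `ζ⋆(3, {2}^b, 3, {2}^c)` with `b + c = n`. -/
noncomputable def threeOneThreeGF (x : ℝ) : ℝ :=
  (genFun (fun n => prependArg 3 (oneThree n) 1) (ENNReal.ofReal x)).toReal

theorem prependArg_four_twos_le (n : ℕ) : prependArg 4 (twos n) 1 ≤ 4 * 8 ^ n := by
  have := starTail_le_two_pow (4 :: List.replicate n 2) (fun j hj => by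
    simp only [List.mem_cons, List.mem_replicate] at hj
    omega) 1 le_rfl
  rw [starTail_cons, List.length_cons, List.length_replicate] at this
  refine this.trans ?_
  norm_cast
  rw [pow_succ']
  exact Nat.mul_le_mul (by norm_num) (Nat.pow_le_pow_left (by norm_num) n)

theorem prependArg_oneThree_le (n : ℕ) : prependArg 3 (oneThree n) 1 ≤ 4 * 8 ^ n := by
  refine le_trans ?_ (twoThrees_le n 1 le_rfl)
  cases n with
  | zero => rw [twoThrees, insertTwos_zero]
  | succ n =>
    rw [twoThrees, insertTwos_succ]
    exact le_self_add

theorem hasSum_fourTwosGF (hx : x ≤ 1 / 16) :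
    HasSum (fun i : ℕ => twosGF x (1 + i) / ((1 + i : ℕ) : ℝ) ^ 4) (fourTwosGF x) := by
  have h := genFun_ne_top prependArg_four_twos_le hx
  rw [genFun_prependArg] at h
  have := hasSum_toReal_prependArg h
  rwa [← genFun_prependArg] at this

theorem hasSum_threeOneThreeGF (hx0 : 0 < x) (hx : x ≤ 1 / 16) :
    HasSum (fun i : ℕ => twosGF x (1 + i) * cubicTail x (1 + i) / ((1 + i : ℕ) : ℝ) ^ 3)
      (threeOneThreeGF x) := by
  have h := genFun_ne_top prependArg_oneThree_le hx
  rw [genFun_prependArg] at h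
  have := hasSum_toReal_prependArg h
  rw [← genFun_prependArg] at this
  convert this using 1
  swap
  · rfl
  ext i
  rw [← oneThreeGF_eq hx0 hx (by omega)]
  rfl

/-- The product `∏_{j ≤ n} (1 - x / j²)`. -/
noncomputable def sineProd (x : ℝ) (n : ℕ) : ℝ :=
  ∏ j ∈ Finset.range n, (1 - x / ((j + 1 : ℕ) : ℝ) ^ 2)

theorem twosGF_eq_mul_sineProd (hx0 : 0 < x) (hx : x ≤ 1 / 16) (n : ℕ) :
    twosGF x (1 + n) = twosGF x 1 * sineProd x n := by
  induction n with
  | zero => simp [sineProd]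
  | succ n ih =>
    rw [← add_assoc, twosGF_succ hx0 hx _ (by omega), ih, sineProd, sineProd,
      Finset.prod_range_succ, add_comm 1 n]
    ring

theorem tendsto_sineProd (hx0 : 0 < x) (hx : x ≤ 1 / 16) :
    Filter.Tendsto (sineProd x) Filter.atTop (nhds (twosGF x 1)⁻¹) := by
  have h0 := one_le_twosGF hx 1 le_rfl
  have h : Filter.Tendsto (fun n => twosGF x (1 + n)) Filter.atTop (nhds 1) := by
    refine ((tendsto_twosGF hx0 hx).comp (Filter.tendsto_add_atTop_nat 1)).congr fun n => ?_
    simp [add_comm]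
  have h1 := h.const_mul (twosGF x 1)⁻¹
  rw [mul_one] at h1
  refine h1.congr fun n => ?_
  rw [twosGF_eq_mul_sineProd hx0 hx, inv_mul_cancel_left₀ (by linarith)]

end

/-! ### Partial fractions of a product with double poles -/

/-- The rational function `∏_{p ∈ s} (1 - x / (v - p)²)`. -/
noncomputable def poleProd (x : ℝ) (s : Finset ℝ) (v : ℝ) : ℝ :=
  ∏ p ∈ s, (1 - x / (v - p) ^ 2)

/-- The logarithmic derivative of `poleProd x s`. -/
noncomputable def poleLogDeriv (x : ℝ) (s : Finset ℝ) (v : ℝ) : ℝ :=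
  ∑ p ∈ s, 2 * x / ((v - p) * ((v - p) ^ 2 - x))

/-- `v` avoids the poles and zeros of the factors of `poleProd x s`. -/
def AvoidsPoles (x : ℝ) (s : Finset ℝ) (v : ℝ) : Prop :=
  ∀ p ∈ s, v - p ≠ 0 ∧ (v - p) ^ 2 - x ≠ 0

section

variable {x : ℝ}

theorem AvoidsPoles.eventually {s : Finset ℝ} {v : ℝ} (h : AvoidsPoles x s v) :
    ∀ᶠ w in nhds v, AvoidsPoles x s w := by
  refine (Filter.eventually_all_finset s).2 fun p hp => ?_
  have h1 : Continuous fun w : ℝ => w - p := by fun_prop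
  have h2 : Continuous fun w : ℝ => (w - p) ^ 2 - x := by fun_prop
  exact (h1.continuousAt.eventually_ne (h p hp).1).and (h2.continuousAt.eventually_ne (h p hp).2)

theorem hasDerivAt_const_div_sub_pow (c p : ℝ) (n : ℕ) {v : ℝ} (h : v - p ≠ 0) :
    HasDerivAt (fun v => c / (v - p) ^ (n + 1)) (-((n + 1) * c) / (v - p) ^ (n + 2)) v := by
  have h1 := ((((hasDerivAt_id' v).sub_const p).fun_pow (n + 1)).fun_inv
    (pow_ne_zero (n + 1) h)).const_mul c
  simp only [← div_eq_mul_inv] at h1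
  refine h1.congr_deriv ?_
  rw [Nat.add_sub_cancel]
  push_cast
  field_simp
  ring

theorem hasDerivAt_poleProd {s : Finset ℝ} {v : ℝ} (h : AvoidsPoles x s v) :
    HasDerivAt (poleProd x s) (poleProd x s v * poleLogDeriv x s v) v := by
  induction s using Finset.induction_on with
  | empty =>
    have : poleProd x ∅ = fun _ => 1 := by
      ext v
      simp [poleProd]
    rw [this]
    simpa [poleLogDeriv] using hasDerivAt_const v (1 : ℝ)
  | insert p s hp ih =>
    have h1 := ih fun q hq => h q (Finset.mem_insert_of_mem hq)
    obtain ⟨h2, h3⟩ := h p (Finset.mem_insert_self _ _)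
    have h4 := (hasDerivAt_const_div_sub_pow x p 1 h2).const_sub 1
    have h5 : poleProd x (insert p s) = fun v => (1 - x / (v - p) ^ 2) * poleProd x s v := by
      ext v
      exact Finset.prod_insert hp
    have h6 : poleLogDeriv x (insert p s) v =
        2 * x / ((v - p) * ((v - p) ^ 2 - x)) + poleLogDeriv x s v := Finset.sum_insert hp
    rw [h5, h6]
    refine (h4.fun_mul h1).congr_deriv ?_
    push_cast
    field_simp
    ring

theorem hasDerivAt_poleLogDeriv {s : Finset ℝ} {v : ℝ} (h : AvoidsPoles x s v) :
    HasDerivAt (poleLogDeriv x s)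
      (∑ p ∈ s, -(2 * x * (3 * (v - p) ^ 2 - x) / ((v - p) ^ 2 * ((v - p) ^ 2 - x) ^ 2))) v := by
  have : poleLogDeriv x s = fun v => ∑ p ∈ s, 2 * x / ((v - p) * ((v - p) ^ 2 - x)) := rfl
  rw [this]
  refine HasDerivAt.fun_sum fun p hp => ?_
  obtain ⟨h2, h3⟩ := h p hp
  have h4 := (hasDerivAt_id' v).sub_const p
  have h5 := ((h4.fun_mul ((h4.fun_pow 2).sub_const x)).fun_inv (mul_ne_zero h2 h3)).const_mul (2 * x)
  simp only [← div_eq_mul_inv] at h5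
  refine h5.congr_deriv ?_
  field_simp
  ring

/-- The function `1 + ∑ (α p / (v - p)² + β p / (v - p))`. -/
noncomputable def poleSum (s : Finset ℝ) (α β : ℝ → ℝ) (v : ℝ) : ℝ :=
  1 + ∑ p ∈ s, (α p / (v - p) ^ 2 + β p / (v - p))

/-- The derivative of `poleSum`. -/
noncomputable def poleSumDeriv (s : Finset ℝ) (α β : ℝ → ℝ) (v : ℝ) : ℝ :=
  ∑ p ∈ s, (-2 * α p / (v - p) ^ 3 - β p / (v - p) ^ 2)

theorem hasDerivAt_poleSum {s : Finset ℝ} (α β : ℝ → ℝ) {v : ℝ} (h : ∀ p ∈ s, v - p ≠ 0) :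
    HasDerivAt (poleSum s α β) (poleSumDeriv s α β v) v := by
  have : poleSum s α β = fun v => 1 + ∑ p ∈ s, (α p / (v - p) ^ 2 + β p / (v - p)) := rfl
  rw [this]
  refine HasDerivAt.const_add 1 (HasDerivAt.fun_sum fun p hp => ?_)
  have h2 := h p hp
  have h3 := (hasDerivAt_const_div_sub_pow (α p) p 1 h2).fun_add
    (hasDerivAt_const_div_sub_pow (β p) p 0 h2)
  simp only [zero_add, pow_one] at h3
  refine h3.congr_deriv ?_
  push_cast
  ring

theorem hasDerivAt_poleSumDeriv {s : Finset ℝ} (α β : ℝ → ℝ) {v : ℝ} (h : ∀ p ∈ s, v - p ≠ 0) :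
    HasDerivAt (poleSumDeriv s α β)
      (∑ p ∈ s, (6 * α p / (v - p) ^ 4 + 2 * β p / (v - p) ^ 3)) v := by
  have : poleSumDeriv s α β = fun v => ∑ p ∈ s, (-2 * α p / (v - p) ^ 3 - β p / (v - p) ^ 2) := rfl
  rw [this]
  refine HasDerivAt.fun_sum fun p hp => ?_
  have h2 := h p hp
  refine ((hasDerivAt_const_div_sub_pow (-2 * α p) p 2 h2).fun_sub
    (hasDerivAt_const_div_sub_pow (β p) p 1 h2)).congr_deriv ?_
  push_cast
  ring

/-- The assumed expansion may be differentiated because avoiding the poles and zeros is an open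
condition. -/
theorem poleProd_mul_poleLogDeriv {s : Finset ℝ} {α β : ℝ → ℝ}
    (hs : ∀ v, AvoidsPoles x s v → poleProd x s v = poleSum s α β v) {v : ℝ}
    (h : AvoidsPoles x s v) :
    poleProd x s v * poleLogDeriv x s v = poleSumDeriv s α β v := by
  refine (hasDerivAt_poleProd h).unique
    ((hasDerivAt_poleSum α β fun p hp => (h p hp).1).congr_of_eventuallyEq ?_)
  filter_upwards [h.eventually] with w hw using hs w hw

/-- The coefficient of the double pole of `poleProd x s` at `p`. -/
noncomputable def doublePoleCoeff (x : ℝ) (s : Finset ℝ) (p : ℝ) : ℝ :=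
  -x * poleProd x (s.erase p) p

/-- The residue of `poleProd x s` at `p`. -/
noncomputable def simplePoleCoeff (x : ℝ) (s : Finset ℝ) (p : ℝ) : ℝ :=
  -x * (poleProd x (s.erase p) p * poleLogDeriv x (s.erase p) p)

theorem poleProd_insert {s : Finset ℝ} {k : ℝ} (hk : k ∉ s) (v : ℝ) :
    poleProd x (insert k s) v = (1 - x / (v - k) ^ 2) * poleProd x s v :=
  Finset.prod_insert hk

theorem poleLogDeriv_insert {s : Finset ℝ} {k : ℝ} (hk : k ∉ s) (v : ℝ) :
    poleLogDeriv x (insert k s) v =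
      2 * x / ((v - k) * ((v - k) ^ 2 - x)) + poleLogDeriv x s v :=
  Finset.sum_insert hk

/-- The partial fraction decomposition of `poleProd x s`. -/
theorem poleProd_eq_poleSum {s : Finset ℝ} (hs : ∀ p ∈ s, AvoidsPoles x (s.erase p) p) {v : ℝ}
    (hv : AvoidsPoles x s v) :
    poleProd x s v = poleSum s (doublePoleCoeff x s) (simplePoleCoeff x s) v := by
  induction s using Finset.induction_on generalizing v with
  | empty => simp [poleProd, poleSum]
  | insert k s hk ih =>
    have ih' := fun (v : ℝ) (hv : AvoidsPoles x s v) => ih (fun p hp q hq => by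
      refine hs p (Finset.mem_insert_of_mem hp) q ?_
      rw [Finset.mem_erase] at hq ⊢
      exact ⟨hq.1, Finset.mem_insert_of_mem hq.2⟩) hv
    have hks : AvoidsPoles x s k := by
      have := hs k (Finset.mem_insert_self _ _)
      rwa [Finset.erase_insert hk] at this
    have hvs : AvoidsPoles x s v := fun p hp => hv p (Finset.mem_insert_of_mem hp)
    have hvk := (hv k (Finset.mem_insert_self _ _)).1
    -- The Laurent coefficients at the new pole k are -x times the value and the derivative of the
    -- old product at k; both are read off its expansion.
    have hderiv := poleProd_mul_poleLogDeriv ih' hks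
    have hval := ih' k hks
    have hα : ∀ p ∈ s, doublePoleCoeff x (insert k s) p
        = (1 - x / (p - k) ^ 2) * doublePoleCoeff x s p := by
      intro p hp
      have hpk : p ≠ k := fun h => hk (h ▸ hp)
      rw [doublePoleCoeff, doublePoleCoeff, Finset.erase_insert_of_ne hpk.symm,
        poleProd_insert (fun h => hk (Finset.mem_of_mem_erase h))]
      ring
    -- The new factor is regular at p. Its derivative there, 2x/(p - k)³, moves part of the double
    -- pole into the residue.
    have hβ : ∀ p ∈ s, simplePoleCoeff x (insert k s) p
        = (1 - x / (p - k) ^ 2) * simplePoleCoeff x s p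
          + 2 * x / (p - k) ^ 3 * doublePoleCoeff x s p := by
      intro p hp
      have hpk : p ≠ k := fun h => hk (h ▸ hp)
      obtain ⟨h1, h2⟩ := hs p (Finset.mem_insert_of_mem hp) k
        (Finset.mem_erase.2 ⟨hpk.symm, Finset.mem_insert_self _ _⟩)
      have hk' : k ∉ s.erase p := fun h => hk (Finset.mem_of_mem_erase h)
      rw [simplePoleCoeff, simplePoleCoeff, doublePoleCoeff, Finset.erase_insert_of_ne hpk.symm,
        poleProd_insert hk', poleLogDeriv_insert hk']
      field_simp
      ring
    have hαk : doublePoleCoeff x (insert k s) k = -x * poleProd x s k := by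
      rw [doublePoleCoeff, Finset.erase_insert hk]
    have hβk : simplePoleCoeff x (insert k s) k
        = -x * (poleProd x s k * poleLogDeriv x s k) := by
      rw [simplePoleCoeff, Finset.erase_insert hk]
    have hterm : ∀ p ∈ s,
        (1 - x / (v - k) ^ 2) * (doublePoleCoeff x s p / (v - p) ^ 2
          + simplePoleCoeff x s p / (v - p))
        = (doublePoleCoeff x (insert k s) p / (v - p) ^ 2
          + simplePoleCoeff x (insert k s) p / (v - p))
          + (-x / (v - k) ^ 2) * (doublePoleCoeff x s p / (k - p) ^ 2
            + simplePoleCoeff x s p / (k - p))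
          + (-x / (v - k)) * (-2 * doublePoleCoeff x s p / (k - p) ^ 3
            - simplePoleCoeff x s p / (k - p) ^ 2) := by
      intro p hp
      rw [hα p hp, hβ p hp]
      have h1 := (hvs p hp).1
      have h2 := (hks p hp).1
      -- Only differences matter: with a = v - p and d = k - p the claim is a rational identity in
      -- a, d and the coefficients.
      obtain ⟨a, ha⟩ : ∃ a, a = v - p := ⟨_, rfl⟩
      obtain ⟨d, hd⟩ : ∃ d, d = k - p := ⟨_, rfl⟩
      have e1 : v - k = a - d := by rw [ha, hd]; ring
      have e2 : p - k = -d := by rw [hd]; ring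
      rw [e1] at hvk ⊢
      rw [← ha] at h1 ⊢
      rw [← hd] at h2 ⊢
      rw [e2]
      field_simp
      ring
    rw [poleProd_insert hk, ih' v hvs, poleSum, mul_add, Finset.mul_sum,
      Finset.sum_congr rfl hterm, Finset.sum_add_distrib, Finset.sum_add_distrib,
      ← Finset.mul_sum, ← Finset.mul_sum, poleSum, Finset.sum_insert hk, hαk, hβk, hderiv, hval,
      poleSum, poleSumDeriv]
    ring

/-- The second derivative of the partial fraction decomposition of `poleProd x s`. -/
theorem sum_poleCoeff {s : Finset ℝ} (hs : ∀ p ∈ s, AvoidsPoles x (s.erase p) p) {v : ℝ}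
    (hv : AvoidsPoles x s v) :
    ∑ p ∈ s, (6 * doublePoleCoeff x s p / (v - p) ^ 4 + 2 * simplePoleCoeff x s p / (v - p) ^ 3)
      = poleProd x s v * (poleLogDeriv x s v ^ 2
        - ∑ p ∈ s, 2 * x * (3 * (v - p) ^ 2 - x) / ((v - p) ^ 2 * ((v - p) ^ 2 - x) ^ 2)) := by
  have h1 := (hasDerivAt_poleSumDeriv (doublePoleCoeff x s) (simplePoleCoeff x s)
    fun p hp => (hv p hp).1)
  -- With P' = PL, the second derivative of the product is (PL)' = P(L² + L').
  have h2 := (hasDerivAt_poleProd hv).mul (hasDerivAt_poleLogDeriv hv)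
  rw [h1.unique (h2.congr_of_eventuallyEq ?_), Finset.sum_neg_distrib]
  · ring
  · filter_upwards [hv.eventually] with w hw
    exact (poleProd_mul_poleLogDeriv (fun v hv => poleProd_eq_poleSum hs hv) hw).symm

end

/-! ### The poles -1, …, -n and the passage n → ∞ -/

/-- Seen from l, the other nodes are -1, …, -l and 1, …, m. For even f this splits the product into
two copies of the same type; for odd f the additive version gives a difference of two sums. -/
theorem prod_range_erase_sub {M : Type*} [CommMonoid M] (f : ℝ → M) (l m : ℕ) :
    ∏ j ∈ (Finset.range (l + 1 + m)).erase l, f ((j : ℝ) - l) =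
      (∏ i ∈ Finset.range l, f (-((1 + i : ℕ) : ℝ))) *
        ∏ i ∈ Finset.range m, f ((1 + i : ℕ) : ℝ) := by
  induction m with
  | zero =>
    rw [add_zero, Finset.range_add_one, Finset.erase_insert Finset.notMem_range_self,
      Finset.range_zero, Finset.prod_empty, mul_one, ← Finset.prod_range_reflect]
    refine Finset.prod_congr rfl fun j hj => ?_
    have : 1 + (l - 1 - j) + j = l := by
      rw [Finset.mem_range] at hj
      omega
    congr 1
    have h2 : (((1 + (l - 1 - j) + j : ℕ)) : ℝ) = l := by rw [this]
    rw [← h2]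
    push_cast
    ring
  | succ m ih =>
    rw [← add_assoc, Finset.range_add_one (n := l + 1 + m), Finset.erase_insert_of_ne (by omega),
      Finset.prod_insert (by simp), ih, Finset.prod_range_succ _ m, mul_comm, mul_assoc]
    congr 3
    push_cast
    ring

theorem sum_range_erase_sub {M : Type*} [AddCommMonoid M] (f : ℝ → M) (l m : ℕ) :
    ∑ j ∈ (Finset.range (l + 1 + m)).erase l, f ((j : ℝ) - l) =
      ∑ i ∈ Finset.range l, f (-((1 + i : ℕ) : ℝ)) + ∑ i ∈ Finset.range m, f ((1 + i : ℕ) : ℝ) :=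
  prod_range_erase_sub (M := Multiplicative M) f l m

/-- The poles `-1, …, -n`. -/
noncomputable def negNodes (n : ℕ) : Finset ℝ :=
  (Finset.range n).image fun j : ℕ => -((1 + j : ℕ) : ℝ)

theorem negNodes_injective : Function.Injective fun j : ℕ => -((1 + j : ℕ) : ℝ) := by
  intro i j h
  simpa using h

/-- The partial sum `∑_{j ≤ n} 1 / (j (j² - x))`. -/
noncomputable def cubicSum (x : ℝ) (n : ℕ) : ℝ := ∑ i ∈ Finset.range n, cubicTerm x (1 + i)

/-- The summand `(3 j² - x) / (j² (j² - x)²)`. -/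
noncomputable def sexticTerm (x : ℝ) (j : ℕ) : ℝ :=
  (3 * (j : ℝ) ^ 2 - x) / ((j : ℝ) ^ 2 * ((j : ℝ) ^ 2 - x) ^ 2)

section

variable {x : ℝ}

theorem avoidsPoles_of_int {a b : ℤ} (hx0 : 0 < x) (hx : x ≤ 1 / 16) (h : a ≠ b) :
    (a : ℝ) - b ≠ 0 ∧ ((a : ℝ) - b) ^ 2 - x ≠ 0 := by
  have h1 : a - b ≠ 0 := sub_ne_zero.2 h
  have h2 : (1 : ℝ) ≤ ((a : ℝ) - b) ^ 2 := by
    have : 1 ≤ (a - b) ^ 2 := by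
      have := sq_pos_of_ne_zero h1
      omega
    exact_mod_cast this
  exact ⟨by exact_mod_cast h1, by linarith⟩

theorem avoidsPoles_negNodes_zero (hx0 : 0 < x) (hx : x ≤ 1 / 16) (n : ℕ) :
    AvoidsPoles x (negNodes n) 0 := by
  intro p hp
  obtain ⟨j, -, rfl⟩ := Finset.mem_image.1 hp
  have := avoidsPoles_of_int (a := 0) (b := -((1 + j : ℕ) : ℤ)) hx0 hx (by omega)
  exact_mod_cast this

theorem avoidsPoles_negNodes_erase (hx0 : 0 < x) (hx : x ≤ 1 / 16) (n : ℕ) :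
    ∀ p ∈ negNodes n, AvoidsPoles x ((negNodes n).erase p) p := by
  intro p hp q hq
  obtain ⟨i, -, rfl⟩ := Finset.mem_image.1 hp
  obtain ⟨hne, hq⟩ := Finset.mem_erase.1 hq
  obtain ⟨j, -, rfl⟩ := Finset.mem_image.1 hq
  have hij : i ≠ j := fun h => hne (by rw [h])
  have := avoidsPoles_of_int (a := -((1 + i : ℕ) : ℤ)) (b := -((1 + j : ℕ) : ℤ)) hx0 hx (by omega)
  exact_mod_cast this

theorem sum_negNodes (f : ℝ → ℝ) (n : ℕ) :
    ∑ p ∈ negNodes n, f p = ∑ j ∈ Finset.range n, f (-((1 + j : ℕ) : ℝ)) :=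
  Finset.sum_image negNodes_injective.injOn

theorem negNodes_erase (n l : ℕ) : (negNodes n).erase (-((1 + l : ℕ) : ℝ)) =
    ((Finset.range n).erase l).image fun j : ℕ => -((1 + j : ℕ) : ℝ) :=
  (Finset.image_erase negNodes_injective _ _).symm

theorem poleProd_negNodes_zero (n : ℕ) : poleProd x (negNodes n) 0 = sineProd x n := by
  rw [poleProd, negNodes, Finset.prod_image negNodes_injective.injOn, sineProd]
  refine Finset.prod_congr rfl fun j _ => ?_
  rw [zero_sub, neg_neg, add_comm]

theorem poleLogDeriv_negNodes_zero (n : ℕ) :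
    poleLogDeriv x (negNodes n) 0 = 2 * x * cubicSum x n := by
  rw [poleLogDeriv, sum_negNodes, cubicSum, Finset.mul_sum]
  refine Finset.sum_congr rfl fun j _ => ?_
  rw [zero_sub, neg_neg, cubicTerm]
  ring

theorem poleProd_negNodes_erase {n l : ℕ} (hl : l < n) :
    poleProd x ((negNodes n).erase (-((1 + l : ℕ) : ℝ))) (-((1 + l : ℕ) : ℝ)) =
      sineProd x l * sineProd x (n - (l + 1)) := by
  obtain ⟨m, rfl⟩ := Nat.exists_eq_add_of_lt hl
  have := prod_range_erase_sub (fun t : ℝ => 1 - x / t ^ 2) l m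
  rw [poleProd, negNodes_erase, Finset.prod_image negNodes_injective.injOn, sineProd, sineProd,
    show l + m + 1 = l + 1 + m by ring, Nat.add_sub_cancel_left]
  simp only [neg_sq, add_comm 1] at this
  rw [← this]
  refine Finset.prod_congr rfl fun j _ => ?_
  push_cast
  ring

theorem poleLogDeriv_negNodes_erase {n l : ℕ} (hl : l < n) :
    poleLogDeriv x ((negNodes n).erase (-((1 + l : ℕ) : ℝ))) (-((1 + l : ℕ) : ℝ)) =
      2 * x * (cubicSum x (n - (l + 1)) - cubicSum x l) := by
  obtain ⟨m, rfl⟩ := Nat.exists_eq_add_of_lt hl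
  have := sum_range_erase_sub (fun t : ℝ => 2 * x * (1 / (t * (t ^ 2 - x)))) l m
  rw [poleLogDeriv, negNodes_erase, Finset.sum_image negNodes_injective.injOn, cubicSum, cubicSum,
    show l + m + 1 = l + 1 + m by ring, Nat.add_sub_cancel_left]
  have h2 : ∑ i ∈ Finset.range l, (2 * x * (1 / (-((1 + i : ℕ) : ℝ)
      * ((-((1 + i : ℕ) : ℝ)) ^ 2 - x)))) = -(2 * x * ∑ i ∈ Finset.range l, cubicTerm x (1 + i)) := by
    rw [Finset.mul_sum, ← Finset.sum_neg_distrib]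
    refine Finset.sum_congr rfl fun i _ => ?_
    rw [cubicTerm, neg_sq, neg_mul, one_div, one_div, inv_neg]
    ring
  rw [h2] at this
  rw [mul_sub, sub_eq_neg_add, Finset.mul_sum (s := Finset.range m)]
  refine Eq.trans (Finset.sum_congr rfl fun j _ => ?_) this
  rw [show -((1 + l : ℕ) : ℝ) - -((1 + j : ℕ) : ℝ) = (j : ℝ) - l by push_cast; ring]
  ring

/-- The summand of the finite sum over the poles. -/
noncomputable def poleTerm (x : ℝ) (n l : ℕ) : ℝ :=
  sineProd x l * sineProd x (n - (l + 1)) * (3 / ((1 + l : ℕ) : ℝ) ^ 4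
    + 2 * x * (cubicSum x (n - (l + 1)) - cubicSum x l) / ((1 + l : ℕ) : ℝ) ^ 3)

/-- This is `sum_poleCoeff` at v = 0, divided by -2x. -/
theorem sum_poleTerm (hx0 : 0 < x) (hx : x ≤ 1 / 16) (n : ℕ) :
    ∑ l ∈ Finset.range n, poleTerm x n l =
      sineProd x n * (∑ j ∈ Finset.range n, sexticTerm x (1 + j) - 2 * x * cubicSum x n ^ 2) := by
  have h := sum_poleCoeff (avoidsPoles_negNodes_erase hx0 hx n) (avoidsPoles_negNodes_zero hx0 hx n)
  rw [sum_negNodes, sum_negNodes, poleProd_negNodes_zero, poleLogDeriv_negNodes_zero] at h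
  have h1 : ∀ l ∈ Finset.range n,
      6 * doublePoleCoeff x (negNodes n) (-((1 + l : ℕ) : ℝ)) / (0 - -((1 + l : ℕ) : ℝ)) ^ 4
        + 2 * simplePoleCoeff x (negNodes n) (-((1 + l : ℕ) : ℝ)) / (0 - -((1 + l : ℕ) : ℝ)) ^ 3
      = -2 * x * poleTerm x n l := by
    intro l hl
    rw [Finset.mem_range] at hl
    rw [doublePoleCoeff, simplePoleCoeff, poleProd_negNodes_erase hl,
      poleLogDeriv_negNodes_erase hl, zero_sub, neg_neg, poleTerm]
    ring
  have h2 : ∀ j ∈ Finset.range n,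
      2 * x * (3 * (0 - -((1 + j : ℕ) : ℝ)) ^ 2 - x) / ((0 - -((1 + j : ℕ) : ℝ)) ^ 2
        * ((0 - -((1 + j : ℕ) : ℝ)) ^ 2 - x) ^ 2) = 2 * x * sexticTerm x (1 + j) := by
    intro j _
    rw [sexticTerm, zero_sub, neg_neg, mul_div_assoc]
  rw [Finset.sum_congr rfl h1, Finset.sum_congr rfl h2, ← Finset.mul_sum, ← Finset.mul_sum] at h
  have h3 : -2 * x ≠ 0 := by linarith
  refine mul_left_cancel₀ h3 ?_
  rw [h]
  ring

theorem sineProd_factor_mem (hx0 : 0 < x) (hx : x ≤ 1 / 16) (j : ℕ) :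
    0 ≤ 1 - x / ((j + 1 : ℕ) : ℝ) ^ 2 ∧ 1 - x / ((j + 1 : ℕ) : ℝ) ^ 2 ≤ 1 := by
  have h1 := one_le_sq_cast (by omega : 1 ≤ j + 1)
  have h2 : x / ((j + 1 : ℕ) : ℝ) ^ 2 ≤ 1 := (div_le_one (by linarith)).2 (by linarith)
  have h3 : 0 ≤ x / ((j + 1 : ℕ) : ℝ) ^ 2 := by positivity
  exact ⟨by linarith, by linarith⟩

theorem abs_sineProd_le (hx0 : 0 < x) (hx : x ≤ 1 / 16) (n : ℕ) : |sineProd x n| ≤ 1 := by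
  rw [sineProd, abs_of_nonneg (Finset.prod_nonneg fun j _ => (sineProd_factor_mem hx0 hx j).1)]
  exact Finset.prod_le_one (fun j _ => (sineProd_factor_mem hx0 hx j).1)
    fun j _ => (sineProd_factor_mem hx0 hx j).2

theorem cubicSum_nonneg (hx : x ≤ 1 / 16) (n : ℕ) : 0 ≤ cubicSum x n :=
  Finset.sum_nonneg fun i _ => (cubicTerm_pos hx (by omega)).le

theorem cubicSum_add_cubicTail (hx0 : 0 < x) (hx : x ≤ 1 / 16) (n : ℕ) :
    cubicSum x n + cubicTail x (1 + n) = cubicTail x 1 := by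
  induction n with
  | zero => simp [cubicSum]
  | succ n ih =>
    rw [← ih, cubicSum, Finset.sum_range_succ, cubicTail_succ hx0 hx (by omega : 1 ≤ 1 + n),
      cubicSum, add_assoc 1 n 1]
    ring

theorem cubicSum_le (hx0 : 0 < x) (hx : x ≤ 1 / 16) (n : ℕ) : cubicSum x n ≤ cubicTail x 1 := by
  have := cubicTail_nonneg hx (by omega : 1 ≤ 1 + n)
  linarith [cubicSum_add_cubicTail hx0 hx n]

theorem tendsto_cubicSum (hx0 : 0 < x) (hx : x ≤ 1 / 16) :
    Filter.Tendsto (cubicSum x) Filter.atTop (nhds (cubicTail x 1)) :=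
  (hasSum_cubicTail hx0 hx le_rfl).tendsto_sum_nat

/-- Both products are at most 1 in absolute value and the partial sums lie in [0, `cubicTail x 1`].
The bound is uniform in n, as dominated convergence requires. -/
theorem abs_poleTerm_le (hx0 : 0 < x) (hx : x ≤ 1 / 16) (n l : ℕ) :
    |poleTerm x n l| ≤ (3 + 2 * x * cubicTail x 1) * (1 / ((1 + l : ℕ) : ℝ) ^ 3) := by
  have h1 := abs_sineProd_le hx0 hx l
  have h2 := abs_sineProd_le hx0 hx (n - (l + 1))
  have h3 : |cubicSum x (n - (l + 1)) - cubicSum x l| ≤ cubicTail x 1 := by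
    rw [abs_le]
    constructor <;> linarith [cubicSum_nonneg hx l, cubicSum_nonneg hx (n - (l + 1)),
      cubicSum_le hx0 hx l, cubicSum_le hx0 hx (n - (l + 1))]
  have h4 : (1 : ℝ) ≤ ((1 + l : ℕ) : ℝ) := by exact_mod_cast (by omega : 1 ≤ 1 + l)
  have h5 : (0 : ℝ) < ((1 + l : ℕ) : ℝ) ^ 3 := by positivity
  have h6 : (3 : ℝ) / ((1 + l : ℕ) : ℝ) ^ 4 ≤ 3 / ((1 + l : ℕ) : ℝ) ^ 3 :=
    div_le_div_of_nonneg_left (by norm_num) h5 (pow_le_pow_right₀ h4 (by norm_num))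
  rw [poleTerm, abs_mul, abs_mul]
  calc _ ≤ 1 * 1 * (3 / ((1 + l : ℕ) : ℝ) ^ 3 + 2 * x * cubicTail x 1 / ((1 + l : ℕ) : ℝ) ^ 3) := by
        refine mul_le_mul (mul_le_mul h1 h2 (abs_nonneg _) zero_le_one) ?_ (abs_nonneg _)
          (by norm_num)
        refine (abs_add_le _ _).trans (add_le_add ?_ ?_)
        · rwa [abs_of_nonneg (by positivity)]
        · rw [abs_div, abs_mul, abs_of_pos h5, abs_of_pos (by linarith : 0 < 2 * x)]
          gcongr
    _ = _ := by ring

theorem summable_one_div_cube : Summable fun l : ℕ => 1 / ((1 + l : ℕ) : ℝ) ^ 3 := by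
  have := (summable_nat_add_iff 1).2 (Real.summable_one_div_nat_pow.2 (by norm_num : 1 < 3))
  simpa only [add_comm] using this

theorem summable_sexticTerm (hx0 : 0 < x) (hx : x ≤ 1 / 16) :
    Summable fun j => sexticTerm x (1 + j) := by
  refine Summable.of_nonneg_of_le (fun j => ?_) (fun j => ?_)
    ((hasSum_weightedTwosGF_div hx0 hx).summable.mul_left (4 / x))
  · have h1 := one_le_sq_cast (by omega : 1 ≤ 1 + j)
    exact div_nonneg (by linarith) (by positivity)
  · have h1 := one_le_sq_cast (by omega : 1 ≤ 1 + j)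
    rw [sexticTerm]
    obtain ⟨y, hy⟩ : ∃ y, y = ((1 + j : ℕ) : ℝ) ^ 2 := ⟨_, rfl⟩
    rw [← hy] at h1 ⊢
    have h2 : 0 < y - x := by linarith
    rw [show 4 / x * (x / (y - x)) = 4 / (y - x) by field_simp,
      div_le_div_iff₀ (by positivity) h2]
    nlinarith [mul_pos h2 h2, mul_nonneg (by linarith : 0 ≤ y - 1) h2.le]

/-- The residue identity for `∏ (1 - x / (j + u)²)`, in the limit of infinitely many factors. -/
theorem three_mul_fourTwosGF_add (hx0 : 0 < x) (hx : x ≤ 1 / 16) :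
    3 * fourTwosGF x + 2 * x * threeOneThreeGF x =
      twosGF x 1 * (∑' j, sexticTerm x (1 + j) - 2 * x * cubicTail x 1 ^ 2) := by
  have hG := one_le_twosGF hx 1 le_rfl
  have hsub : ∀ l : ℕ, Filter.Tendsto (fun n => n - (l + 1)) Filter.atTop Filter.atTop :=
    fun l => Filter.tendsto_sub_atTop_nat (l + 1)
  -- The finite sum over l < n is extended by zero, so that the limit can be taken termwise.
  have hlim : Filter.Tendsto (fun n => ∑' l, if l < n then poleTerm x n l else 0) Filter.atTop
      (nhds (∑' l, sineProd x l * (twosGF x 1)⁻¹ * (3 / ((1 + l : ℕ) : ℝ) ^ 4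
        + 2 * x * (cubicTail x 1 - cubicSum x l) / ((1 + l : ℕ) : ℝ) ^ 3))) := by
    refine tendsto_tsum_of_dominated_convergence
      (bound := fun l => (3 + 2 * x * cubicTail x 1) * (1 / ((1 + l : ℕ) : ℝ) ^ 3))
      (summable_one_div_cube.mul_left _) (fun l => ?_) (Filter.Eventually.of_forall fun n l => ?_)
    · have h1 : Filter.Tendsto (fun n => poleTerm x n l) Filter.atTop
          (nhds (sineProd x l * (twosGF x 1)⁻¹ * (3 / ((1 + l : ℕ) : ℝ) ^ 4
            + 2 * x * (cubicTail x 1 - cubicSum x l) / ((1 + l : ℕ) : ℝ) ^ 3))) :=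
        (((tendsto_sineProd hx0 hx).comp (hsub l)).const_mul _).mul
          ((((((tendsto_cubicSum hx0 hx).comp (hsub l)).sub_const _).const_mul _).div_const
            _).const_add _)
      refine h1.congr' ?_
      filter_upwards [Filter.eventually_gt_atTop l] with n hn
      rw [if_pos hn]
    · split_ifs
      · exact abs_poleTerm_le hx0 hx n l
      · rw [norm_zero]
        have := cubicTail_nonneg hx (le_refl 1)
        positivity
  have hfin : ∀ n, (∑' l, if l < n then poleTerm x n l else 0) =
      sineProd x n * (∑ j ∈ Finset.range n, sexticTerm x (1 + j) - 2 * x * cubicSum x n ^ 2) := by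
    intro n
    rw [← sum_poleTerm hx0 hx, tsum_eq_sum (s := Finset.range n)]
    · refine Finset.sum_congr rfl fun l hl => ?_
      rw [if_pos (Finset.mem_range.1 hl)]
    · intro l hl
      rw [if_neg (by simpa using hl)]
  simp only [hfin] at hlim
  have hlim2 := (tendsto_sineProd hx0 hx).mul
    ((summable_sexticTerm hx0 hx).hasSum.tendsto_sum_nat.sub
      (((tendsto_cubicSum hx0 hx).pow 2).const_mul (2 * x)))
  have heq := tendsto_nhds_unique hlim hlim2
  have hA := ((hasSum_fourTwosGF hx).mul_left 3).add
    ((hasSum_threeOneThreeGF hx0 hx).mul_left (2 * x))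
  rw [← hA.tsum_eq]
  -- The limit of the second product in `poleTerm` is the inverse of `twosGF x 1`, and the first is
  -- `twosGF x (1 + l) / twosGF x 1`; hence the square.
  have hterm : ∀ l : ℕ, 3 * (twosGF x (1 + l) / ((1 + l : ℕ) : ℝ) ^ 4)
      + 2 * x * (twosGF x (1 + l) * cubicTail x (1 + l) / ((1 + l : ℕ) : ℝ) ^ 3)
      = twosGF x 1 ^ 2 * (sineProd x l * (twosGF x 1)⁻¹ * (3 / ((1 + l : ℕ) : ℝ) ^ 4
        + 2 * x * (cubicTail x 1 - cubicSum x l) / ((1 + l : ℕ) : ℝ) ^ 3)) := by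
    intro l
    rw [twosGF_eq_mul_sineProd hx0 hx, ← cubicSum_add_cubicTail hx0 hx l]
    have : twosGF x 1 ≠ 0 := by linarith
    field_simp
    ring
  rw [tsum_congr hterm, tsum_mul_left, heq]
  have : twosGF x 1 ≠ 0 := by linarith
  field_simp

/-- The generating function form of the evaluation of `ζ⋆(4, {2}ⁿ)`. -/
theorem genFun_identity (hx0 : 0 < x) (hx : x ≤ 1 / 16) :
    3 * fourTwosGF x + 2 * x * (threeOneThreeGF x + 2 * twoThreesGF x 1) =
      twosGF x 1 * ∑' j : ℕ, (3 * ((1 + j : ℕ) : ℝ) ^ 2 + x)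
        / (((1 + j : ℕ) : ℝ) ^ 2 * (((1 + j : ℕ) : ℝ) ^ 2 - x) ^ 2) := by
  have h1 := three_mul_fourTwosGF_add hx0 hx
  have h2 := two_mul_twoThreesGF hx0 hx
  -- The squares of `cubicTerm`, weighted by 2x, change the numerator 3j² - x into 3j² + x.
  have h3 : ∑' j : ℕ, (3 * ((1 + j : ℕ) : ℝ) ^ 2 + x)
        / (((1 + j : ℕ) : ℝ) ^ 2 * (((1 + j : ℕ) : ℝ) ^ 2 - x) ^ 2)
      = ∑' j, sexticTerm x (1 + j) + 2 * x * ∑' j, cubicTerm x (1 + j) ^ 2 := by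
    rw [← tsum_mul_left, ← (summable_sexticTerm hx0 hx).tsum_add
      ((summable_cubicTerm_sq hx0 hx).mul_left _)]
    refine tsum_congr fun j => ?_
    rw [sexticTerm, cubicTerm, div_pow, one_pow, mul_pow]
    ring
  rw [h3]
  linear_combination h1 + 2 * x * h2

end

/-! ### Comparing coefficients of power series -/

theorem hasSum_tsum_comm_of_nonneg {a : ℕ → ℕ → ℝ} (ha : ∀ j n, 0 ≤ a j n) {f : ℕ → ℝ}
    (h : ∀ j, HasSum (a j) (f j)) (hf : Summable f) :
    HasSum (fun n => ∑' j, a j n) (∑' j, f j) := by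
  have h1 : Summable fun p : ℕ × ℕ => a p.1 p.2 := by
    refine (summable_prod_of_nonneg fun p => ha p.1 p.2).2 ⟨fun j => (h j).summable, ?_⟩
    simpa only [(h _).tsum_eq] using hf
  have h2 : Summable fun p : ℕ × ℕ => a p.2 p.1 := h1.prod_symm
  have h3 : ∑' j, f j = ∑' n, ∑' j, a j n := by
    rw [Summable.tsum_comm h1]
    exact tsum_congr fun j => (h j).tsum_eq.symm
  rw [h3]
  exact h2.prod.hasSum

theorem hasSum_of_eq {f g : ℕ → ℝ} {a b : ℝ} (h : HasSum f a) (hfg : ∀ n, g n = f n)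
    (hab : b = a) : HasSum g b := by
  rwa [funext hfg, hab]

theorem first_coeff_eq_zero_of_hasSum_zero {c : ℕ → ℝ} {r : ℝ} (hr : 0 < r)
    (h : ∀ x, 0 < x → x ≤ r → HasSum (fun n => c n * x ^ n) 0) : c 0 = 0 := by
  have hs : Summable fun n => |c (n + 1)| * r ^ n := by
    have := ((summable_nat_add_iff 1).2 (h r hr le_rfl).summable.abs).mul_left (1 / r)
    refine this.congr fun n => ?_
    rw [abs_mul, abs_of_pos (pow_pos hr _), pow_succ]
    field_simp
  have hb : ∀ x, 0 < x → x ≤ r → |c 0| ≤ x * ∑' n, |c (n + 1)| * r ^ n := by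
    intro x hx hxr
    have h1 := (hasSum_nat_add_iff' 1).2 (h x hx hxr)
    simp only [Finset.sum_range_one, pow_zero, mul_one, zero_sub] at h1
    rw [← abs_neg, ← h1.tsum_eq, ← tsum_mul_left]
    have hle : ∀ n, ‖c (n + 1) * x ^ (n + 1)‖ ≤ x * (|c (n + 1)| * r ^ n) := by
      intro n
      rw [norm_mul, Real.norm_eq_abs, norm_pow, Real.norm_of_nonneg hx.le, pow_succ]
      have := mul_le_mul_of_nonneg_left (pow_le_pow_left₀ hx.le hxr n) (abs_nonneg (c (n + 1)))
      nlinarith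
    exact tsum_of_norm_bounded (hs.mul_left x).hasSum hle
  by_contra hc
  have hc' : 0 < |c 0| := abs_pos.2 hc
  obtain ⟨K, hK⟩ : ∃ K, K = ∑' n, |c (n + 1)| * r ^ n := ⟨_, rfl⟩
  have hK0 : 0 ≤ K := hK ▸ tsum_nonneg fun n => by positivity
  -- At this x one has x K < |c 0|, contradicting the bound; K + 1 keeps the denominator positive
  -- when K = 0.
  have := hb (min r (|c 0| / (2 * (K + 1)))) (lt_min hr (by positivity)) (min_le_left _ _)
  rw [← hK] at this
  have h2 : min r (|c 0| / (2 * (K + 1))) * K ≤ |c 0| / (2 * (K + 1)) * K :=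
    mul_le_mul_of_nonneg_right (min_le_right _ _) hK0
  have h3 : |c 0| / (2 * (K + 1)) * K < |c 0| := by
    rw [div_mul_eq_mul_div, div_lt_iff₀ (by positivity)]
    nlinarith
  linarith

theorem coeff_eq_zero_of_hasSum_zero {r : ℝ} (hr : 0 < r) (n : ℕ) {c : ℕ → ℝ}
    (h : ∀ x, 0 < x → x ≤ r → HasSum (fun n => c n * x ^ n) 0) : c n = 0 := by
  induction n generalizing c with
  | zero => exact first_coeff_eq_zero_of_hasSum_zero hr h
  | succ n ih =>
    refine ih (c := fun n => c (n + 1)) fun x hx hxr => ?_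
    have h1 := ((hasSum_nat_add_iff' 1).2 (h x hx hxr)).mul_left (1 / x)
    simp only [Finset.sum_range_one, pow_zero, mul_one, zero_sub,
      first_coeff_eq_zero_of_hasSum_zero hr h, neg_zero, mul_zero] at h1
    refine hasSum_of_eq h1 (fun m => ?_) rfl
    rw [pow_succ]
    field_simp

/-- Uniqueness of power series expansions to the right of `0`. -/
theorem coeff_unique {r : ℝ} (hr : 0 < r) {a b : ℕ → ℝ} {F : ℝ → ℝ}
    (ha : ∀ x, 0 < x → x ≤ r → HasSum (fun n => a n * x ^ n) (F x))
    (hb : ∀ x, 0 < x → x ≤ r → HasSum (fun n => b n * x ^ n) (F x)) (n : ℕ) : a n = b n := by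
  have := coeff_eq_zero_of_hasSum_zero hr n (c := fun n => a n - b n) fun x hx hxr => by
    simpa [sub_mul] using (ha x hx hxr).sub (hb x hx hxr)
  linarith

/-- The coefficient sequence of `x * F` for a power series `F`. -/
def shiftCoeff (a : ℕ → ℝ) : ℕ → ℝ
  | 0 => 0
  | n + 1 => a n

theorem hasSum_shiftCoeff {a : ℕ → ℝ} {x A : ℝ} (h : HasSum (fun n => a n * x ^ n) A) :
    HasSum (fun n => shiftCoeff a n * x ^ n) (x * A) := by
  refine (hasSum_nat_add_iff' 1).1 ?_
  simp only [shiftCoeff, Finset.sum_range_one, zero_mul, sub_zero]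
  refine hasSum_of_eq (h.mul_left x) (fun n => ?_) rfl
  ring

theorem hasSum_cauchyProduct {a b : ℕ → ℝ} {x A B : ℝ} (ha : HasSum (fun n => a n * x ^ n) A)
    (hb : HasSum (fun n => b n * x ^ n) B) :
    HasSum (fun n => (∑ p ∈ Finset.HasAntidiagonal.antidiagonal n, a p.1 * b p.2) * x ^ n)
      (A * B) := by
  have h1 := summable_norm_sum_mul_antidiagonal_of_summable_norm ha.summable.norm hb.summable.norm
  have h2 := tsum_mul_tsum_eq_tsum_sum_antidiagonal_of_summable_norm
    ha.summable.norm hb.summable.norm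
  rw [ha.tsum_eq, hb.tsum_eq] at h2
  rw [h2]
  refine hasSum_of_eq h1.of_norm.hasSum (fun n => ?_) rfl
  rw [Finset.sum_mul]
  refine Finset.sum_congr rfl fun p hp => ?_
  rw [← Finset.HasAntidiagonal.mem_antidiagonal.1 hp, pow_add]
  ring

/-! ### Expansions in zeta values -/

/-- The zeta value `∑_{j ≥ 1} 1 / j ^ k`. -/
noncomputable def zetaNat (k : ℕ) : ℝ := ∑' j : ℕ, 1 / ((1 + j : ℕ) : ℝ) ^ k

/-- The coefficients `ζ(2n)` of `∑ x / (j² - x)`, without constant term. -/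
noncomputable def zetaEven (n : ℕ) : ℝ := if n = 0 then 0 else zetaNat (2 * n)

section

variable {x : ℝ}

theorem hasSum_zetaEven (hx0 : 0 < x) (hx : x ≤ 1 / 16) :
    HasSum (fun n => zetaEven n * x ^ n) (∑' j : ℕ, x / (((1 + j : ℕ) : ℝ) ^ 2 - x)) := by
  have h := hasSum_tsum_comm_of_nonneg
    (a := fun j n => 1 / ((1 + j : ℕ) : ℝ) ^ (2 * (n + 1)) * x ^ (n + 1))
    (f := fun j => x / (((1 + j : ℕ) : ℝ) ^ 2 - x))
    (fun j n => by positivity) (fun j => ?_) (hasSum_weightedTwosGF_div hx0 hx).summable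
  · refine (hasSum_nat_add_iff' 1).1 ?_
    simp only [Finset.sum_range_one, zetaEven, if_true, zero_mul, sub_zero, Nat.add_eq_zero_iff,
      one_ne_zero, and_false, if_false, zetaNat, ← tsum_mul_right]
    exact h
  · have h1 := one_le_sq_cast (by omega : 1 ≤ 1 + j)
    obtain ⟨y, hy⟩ : ∃ y, y = ((1 + j : ℕ) : ℝ) ^ 2 := ⟨_, rfl⟩
    simp only [pow_mul, ← hy] at h1 ⊢
    have h2 : x / y < 1 := (div_lt_one (by linarith)).2 (by linarith)
    have h3 : y - x ≠ 0 := by linarith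
    have h4 : y ≠ 0 := by linarith
    refine hasSum_of_eq ((hasSum_geometric_of_lt_one (by positivity) h2).mul_left (x / y)) (fun n => ?_) ?_
    · rw [← pow_succ', div_pow]
      ring
    · rw [one_sub_div h4, inv_div]
      field_simp

theorem hasSum_geometric_linear {t : ℝ} (ht0 : 0 ≤ t) (ht : t < 1) :
    HasSum (fun n : ℕ => (4 * (n : ℝ) + 3) * t ^ n) ((3 + t) / (1 - t) ^ 2) := by
  have h1 := hasSum_coe_mul_geometric_of_norm_lt_one (r := t)
    (by rwa [Real.norm_of_nonneg ht0])
  have h2 := hasSum_geometric_of_lt_one ht0 ht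
  have h3 : 1 - t ≠ 0 := by linarith
  refine hasSum_of_eq ((h1.mul_left 4).add (h2.mul_left 3)) (fun n => ?_) ?_
  · ring
  · field_simp
    ring

/-- With t = x/j² the summand is j⁻⁴ (3 + t)/(1 - t)², which is where the weights 4n + 3 come from.
-/
theorem hasSum_zetaNat_linear (hx0 : 0 < x) (hx : x ≤ 1 / 16) :
    HasSum (fun n : ℕ => (4 * (n : ℝ) + 3) * zetaNat (2 * n + 4) * x ^ n)
      (∑' j : ℕ, (3 * ((1 + j : ℕ) : ℝ) ^ 2 + x)
        / (((1 + j : ℕ) : ℝ) ^ 2 * (((1 + j : ℕ) : ℝ) ^ 2 - x) ^ 2)) := by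
  have h := hasSum_tsum_comm_of_nonneg
    (a := fun j n => (4 * (n : ℝ) + 3) * (1 / ((1 + j : ℕ) : ℝ) ^ (2 * n + 4)) * x ^ n)
    (f := fun j => (3 * ((1 + j : ℕ) : ℝ) ^ 2 + x)
        / (((1 + j : ℕ) : ℝ) ^ 2 * (((1 + j : ℕ) : ℝ) ^ 2 - x) ^ 2))
    (fun j n => by positivity) (fun j => ?_) ?_
  · simp only [tsum_mul_right, tsum_mul_left] at h
    exact h
  · have h1 := one_le_sq_cast (by omega : 1 ≤ 1 + j)
    have e : ∀ n : ℕ, ((1 + j : ℕ) : ℝ) ^ (2 * n + 4)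
        = (((1 + j : ℕ) : ℝ) ^ 2) ^ (n + 2) := fun n => by
      rw [← pow_mul]
      ring_nf
    obtain ⟨y, hy⟩ : ∃ y, y = ((1 + j : ℕ) : ℝ) ^ 2 := ⟨_, rfl⟩
    simp only [e, ← hy] at h1 ⊢
    have h2 : x / y < 1 := (div_lt_one (by linarith)).2 (by linarith)
    have h3 : y - x ≠ 0 := by linarith
    have h4 : y ≠ 0 := by linarith
    refine hasSum_of_eq ((hasSum_geometric_linear (by positivity) h2).mul_left (1 / y ^ 2)) (fun n => ?_) ?_
    · rw [div_pow]
      field_simp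
      ring
    · rw [one_sub_div h4]
      field_simp
  · have := (summable_sexticTerm hx0 hx).add ((summable_cubicTerm_sq hx0 hx).mul_left (2 * x))
    refine this.congr fun j => ?_
    rw [sexticTerm, cubicTerm, div_pow, one_pow, mul_pow]
    ring

end

/-- The value `ζ⋆({2}ⁿ)`. -/
noncomputable def zetaStarTwos (n : ℕ) : ℝ := (twos n 1).toReal

/-- Newton's identity between complete symmetric functions and power sums of the 1/j², from the
logarithmic derivative of the product. -/
theorem zetaStarTwos_newton (n : ℕ) :
    n * zetaStarTwos n =
      ∑ p ∈ Finset.HasAntidiagonal.antidiagonal n, zetaStarTwos p.1 * zetaEven p.2 := by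
  refine coeff_unique (a := fun n : ℕ => (n : ℝ) * zetaStarTwos n)
    (b := fun n => ∑ p ∈ Finset.HasAntidiagonal.antidiagonal n, zetaStarTwos p.1 * zetaEven p.2)
    (r := 1 / 16) (by norm_num) (F := fun x => weightedTwosGF x 1) (fun x hx0 hx => ?_)
    (fun x hx0 hx => ?_) n
  · have := hasSum_toReal_genFun hx0.le (genFun_weightedTwos_ne_top hx le_rfl)
    simp only [ENNReal.toReal_mul, ENNReal.toReal_natCast] at this
    exact this
  · have h1 := hasSum_cauchyProduct
      (hasSum_toReal_genFun hx0.le (genFun_twos_ne_top hx le_rfl)) (hasSum_zetaEven hx0 hx)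
    rw [(hasSum_weightedTwosGF_div hx0 hx).tsum_eq] at h1
    have hG := one_le_twosGF hx 1 le_rfl
    have hG' : twosGF x 1 ≠ 0 := by linarith
    have : twosGF x 1 * (weightedTwosGF x 1 / twosGF x 1) = weightedTwosGF x 1 := by field_simp
    rw [← this]
    exact h1

theorem three_mul_zetaStar_four_twos (n : ℕ) :
    3 * (prependArg 4 (twos n) 1).toReal + 2 * shiftCoeff (fun n =>
        (prependArg 3 (oneThree n) 1).toReal + 2 * (twoThrees n 1).toReal) n =
      ∑ p ∈ Finset.HasAntidiagonal.antidiagonal n,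
        zetaStarTwos p.1 * ((4 * (p.2 : ℝ) + 3) * zetaNat (2 * p.2 + 4)) := by
  refine coeff_unique (a := fun n => 3 * (prependArg 4 (twos n) 1).toReal + 2 * shiftCoeff
      (fun n => (prependArg 3 (oneThree n) 1).toReal + 2 * (twoThrees n 1).toReal) n)
    (b := fun n => ∑ p ∈ Finset.HasAntidiagonal.antidiagonal n,
        zetaStarTwos p.1 * ((4 * (p.2 : ℝ) + 3) * zetaNat (2 * p.2 + 4)))
    (r := 1 / 16) (by norm_num)
    (F := fun x => 3 * fourTwosGF x + 2 * x * (threeOneThreeGF x + 2 * twoThreesGF x 1))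
    (fun x hx0 hx => ?_) (fun x hx0 hx => ?_) n
  · have h1 := hasSum_toReal_genFun hx0.le (genFun_ne_top prependArg_four_twos_le hx)
    have h2 := hasSum_toReal_genFun hx0.le (genFun_ne_top prependArg_oneThree_le hx)
    have h3 := hasSum_toReal_genFun hx0.le (genFun_twoThrees_ne_top hx le_rfl)
    have h4 : HasSum (fun n => ((prependArg 3 (oneThree n) 1).toReal
        + 2 * (twoThrees n 1).toReal) * x ^ n) (threeOneThreeGF x + 2 * twoThreesGF x 1) := by
      refine hasSum_of_eq (h2.add (h3.mul_left 2)) (fun n => ?_) ?_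
      · ring
      · rfl
    refine hasSum_of_eq ((h1.mul_left 3).add ((hasSum_shiftCoeff h4).mul_left 2)) (fun n => ?_) ?_
    · ring
    · rw [fourTwosGF]
      ring
  · exact hasSum_of_eq (hasSum_cauchyProduct
      (hasSum_toReal_genFun hx0.le (genFun_twos_ne_top hx le_rfl)) (hasSum_zetaNat_linear hx0 hx))
      (fun _ => rfl) (genFun_identity hx0 hx)

/-! ### Bernoulli generating series -/

open scoped Nat in
/-- The even coefficients `B₂ₙ / (2n)!` of `t / (eᵗ - 1)`. -/
noncomputable def bernoulliEven (n : ℕ) : ℚ := bernoulli (2 * n) / (2 * n)!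

/-- The even coefficients of `t e^{t / 2} / (eᵗ - 1)`. -/
noncomputable def bernoulliHalf (n : ℕ) : ℚ := (2 / 4 ^ n - 1) * bernoulliEven n

section

open PowerSeries

theorem coeff_bernoulliPowerSeries_of_ne_one {n : ℕ} (hn : n ≠ 1) :
    coeff n (bernoulliPowerSeries ℚ) = coeff n (expand 2 two_ne_zero (mk bernoulliEven)) := by
  rw [coeff_expand, bernoulliPowerSeries, coeff_mk]
  split_ifs with h
  · obtain ⟨m, rfl⟩ := h
    rw [Nat.mul_div_cancel_left m two_pos, coeff_mk, bernoulliEven]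
    simp
  · rw [bernoulli_eq_zero_of_odd (Nat.odd_iff.2 (by omega)) (by omega)]
    simp

theorem coeff_one_bernoulliPowerSeries : coeff 1 (bernoulliPowerSeries ℚ) = -1 / 2 := by
  rw [bernoulliPowerSeries, coeff_mk, bernoulli_one]
  simp

theorem bernoulliPowerSeries_eq :
    bernoulliPowerSeries ℚ = expand 2 two_ne_zero (mk bernoulliEven) - C (1 / 2) * X := by
  ext n
  rw [map_sub, coeff_C_mul, coeff_X]
  split_ifs with h
  · subst h
    rw [coeff_one_bernoulliPowerSeries, coeff_expand, if_neg (by norm_num)]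
    norm_num
  · rw [coeff_bernoulliPowerSeries_of_ne_one h]
    simp

theorem exp_sub_one_ne_zero : exp ℚ - 1 ≠ 0 := fun h => by
  have := bernoulliPowerSeries_mul_exp_sub_one ℚ
  rw [h, mul_zero] at this
  exact X_ne_zero this.symm

/-- The Riccati equation of B = t/(eᵗ - 1), found by differentiating B (eᵗ - 1) = t. -/
theorem X_mul_derivative_bernoulliPowerSeries :
    X * d⁄dX ℚ (bernoulliPowerSeries ℚ) = bernoulliPowerSeries ℚ
      - X * bernoulliPowerSeries ℚ - bernoulliPowerSeries ℚ ^ 2 := by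
  have h1 := bernoulliPowerSeries_mul_exp_sub_one ℚ
  have h2 := congrArg (d⁄dX ℚ) h1
  rw [Derivation.leibniz, map_sub, derivative_exp, Derivation.map_one_eq_zero, sub_zero,
    derivative_X, smul_eq_mul, smul_eq_mul] at h2
  refine mul_right_cancel₀ exp_sub_one_ne_zero ?_
  linear_combination (bernoulliPowerSeries ℚ - 1) * h1 + X * h2

theorem exp_half_mul_self : rescale (1 / 2 : ℚ) (exp ℚ) * rescale (1 / 2 : ℚ) (exp ℚ) = exp ℚ := by
  rw [exp_mul_exp_eq_exp_add]
  norm_num [rescale_one]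

theorem derivative_exp_half :
    d⁄dX ℚ (rescale (1 / 2 : ℚ) (exp ℚ)) = C (1 / 2) * rescale (1 / 2 : ℚ) (exp ℚ) := by
  ext n
  have h := congrArg (coeff n) (derivative_exp ℚ)
  rw [coeff_derivative] at h
  rw [coeff_derivative, coeff_C_mul, coeff_rescale, coeff_rescale, ← h]
  ring

theorem C_half_mul_two : (C (1 / 2 : ℚ) : ℚ⟦X⟧) * 2 = 1 := by
  rw [show (2 : ℚ⟦X⟧) = C 2 from (map_ofNat _ 2).symm, ← map_mul]
  norm_num

/-- With u = e^{t/2} this is u/(u² - 1) = 1/(u - 1) - 1/(u² - 1), multiplied by t. -/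
theorem bernoulliPowerSeries_mul_exp_half :
    bernoulliPowerSeries ℚ * rescale (1 / 2 : ℚ) (exp ℚ) =
      2 * rescale (1 / 2 : ℚ) (bernoulliPowerSeries ℚ) - bernoulliPowerSeries ℚ := by
  have h1 := bernoulliPowerSeries_mul_exp_sub_one ℚ
  have h2 := congrArg (rescale (1 / 2 : ℚ)) h1
  rw [map_mul, map_sub, map_one, rescale_X] at h2
  have h3 : rescale (1 / 2 : ℚ) (exp ℚ) - 1 ≠ 0 := by
    intro h
    have := exp_half_mul_self
    rw [sub_eq_zero.1 h, mul_one] at this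
    exact exp_sub_one_ne_zero (by rw [← this, sub_self])
  refine mul_right_cancel₀ h3 ?_
  rw [← exp_half_mul_self] at h1
  linear_combination h1 - 2 * h2 - X * C_half_mul_two

theorem bernoulliPowerSeries_mul_exp_half_eq :
    bernoulliPowerSeries ℚ * rescale (1 / 2 : ℚ) (exp ℚ) =
      expand 2 two_ne_zero (mk bernoulliHalf) := by
  rw [bernoulliPowerSeries_mul_exp_half]
  ext n
  rw [map_sub, show (2 : ℚ⟦X⟧) = C 2 from (map_ofNat _ 2).symm, coeff_C_mul, coeff_rescale]
  by_cases hn : n = 1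
  · subst hn
    rw [coeff_expand, if_neg (by norm_num)]
    ring
  · rw [coeff_bernoulliPowerSeries_of_ne_one hn, coeff_expand, coeff_expand]
    split_ifs with h
    · obtain ⟨m, rfl⟩ := h
      rw [Nat.mul_div_cancel_left m two_pos, coeff_mk, coeff_mk, bernoulliHalf, pow_mul,
        show ((1 / 2 : ℚ) ^ 2) = 1 / 4 by norm_num, one_div_pow]
      ring
    · ring

theorem coeff_X_mul_derivative {R : Type*} [CommSemiring R] (f : R⟦X⟧) (n : ℕ) :
    coeff n (X * d⁄dX R f) = n * coeff n f := by
  cases n with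
  | zero => simp
  | succ n =>
    rw [coeff_succ_X_mul, coeff_derivative]
    push_cast
    ring

/-- Substituting B = c - t/2, with c even, into the Riccati equation gives c² = c - t c' + t²/4; the
last term is what excludes n = 1. -/
theorem coeff_bernoulliEven_sq {n : ℕ} (hn : n ≠ 1) :
    coeff n (mk bernoulliEven * mk bernoulliEven) = (1 - 2 * n) * bernoulliEven n := by
  have h := X_mul_derivative_bernoulliPowerSeries
  obtain ⟨c, hc⟩ : ∃ c, c = expand 2 two_ne_zero (mk bernoulliEven) := ⟨_, rfl⟩
  rw [bernoulliPowerSeries_eq, ← hc, map_sub, Derivation.leibniz, derivative_X, derivative_C,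
    smul_eq_mul, smul_eq_mul] at h
  have h2 : c * c = c - X * d⁄dX ℚ c + C (1 / 4) * X ^ 2 := by
    have h3 : (C (1 / 4 : ℚ) : ℚ⟦X⟧) = C (1 / 2) * C (1 / 2) := by
      rw [← map_mul]
      norm_num
    rw [h3]
    linear_combination h + (X * c - C (1 / 2) * X ^ 2) * C_half_mul_two
  have h4 := congrArg (coeff (2 * n)) h2
  rw [map_add, map_sub, coeff_X_mul_derivative, coeff_C_mul, coeff_X_pow, if_neg (by omega), hc,
    ← map_mul, coeff_expand_mul, coeff_expand_mul, coeff_mk] at h4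
  rw [h4]
  push_cast
  ring

/-- For H = B e^{t/2} the Riccati equation gives t H'/H = 1 - B - t/2. This is the same recursion as
`zetaStarTwos_newton`, up to scaling. -/
theorem coeff_bernoulliHalf_mul (n : ℕ) :
    coeff n (mk bernoulliHalf * (1 - mk bernoulliEven)) = 2 * n * bernoulliHalf n := by
  have h := X_mul_derivative_bernoulliPowerSeries
  have h1 := bernoulliPowerSeries_mul_exp_half_eq
  have h2 : X * d⁄dX ℚ (expand 2 two_ne_zero (mk bernoulliHalf)) =
      expand 2 two_ne_zero (mk bernoulliHalf * (1 - mk bernoulliEven)) := by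
    have h3 : expand 2 two_ne_zero (mk bernoulliEven)
        = bernoulliPowerSeries ℚ + C (1 / 2) * X := by
      rw [bernoulliPowerSeries_eq]
      ring
    rw [map_mul, map_sub, map_one, h3, ← h1, Derivation.leibniz, derivative_exp_half,
      smul_eq_mul, smul_eq_mul]
    linear_combination rescale (1 / 2 : ℚ) (exp ℚ) * h
      + bernoulliPowerSeries ℚ * rescale (1 / 2 : ℚ) (exp ℚ) * X * C_half_mul_two
  have h4 := congrArg (coeff (2 * n)) h2
  rw [coeff_X_mul_derivative, coeff_expand_mul, coeff_expand_mul, coeff_mk] at h4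
  rw [← h4]
  push_cast
  ring

end

/-! ### Euler's evaluations and the second-order Newton identity -/

theorem one_le_twos (n : ℕ) : 1 ≤ twos n 1 := by
  induction n with
  | zero => rw [twos_zero]
  | succ n ih =>
    rw [twos_succ, prependArg_succ]
    simpa using ih.trans le_self_add

theorem zetaStarTwos_pos (n : ℕ) : 0 < zetaStarTwos n :=
  ENNReal.toReal_pos (zero_lt_one.trans_le (one_le_twos n)).ne'
    ((twos_le n 1 le_rfl).trans_lt (by simp [lt_top_iff_ne_top])).ne

theorem zetaNat_two_mul {k : ℕ} (hk : k ≠ 0) :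
    zetaNat (2 * k) = -(-(2 * Real.pi) ^ 2) ^ k * bernoulliEven k / 2 := by
  have h := (hasSum_nat_add_iff' 1).2 (hasSum_zeta_nat hk)
  simp only [Finset.sum_range_one, Nat.cast_zero, zero_pow (by omega : 2 * k ≠ 0), div_zero,
    sub_zero, add_comm _ 1] at h
  rw [zetaNat, h.tsum_eq, bernoulliEven, neg_pow ((2 * Real.pi) ^ 2), ← pow_mul, mul_pow]
  have : (2 : ℝ) ^ (2 * k) = 2 ^ (2 * k - 1) * 2 := by
    rw [← pow_succ]
    congr 1
    omega
  rw [this]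
  push_cast
  ring

theorem bernoulliEven_zero : bernoulliEven 0 = 1 := by simp [bernoulliEven]

theorem bernoulliHalf_zero : bernoulliHalf 0 = 1 := by
  norm_num [bernoulliHalf, bernoulliEven_zero]

open PowerSeries in
theorem zetaEven_eq (n : ℕ) : zetaEven n =
    (-(2 * Real.pi) ^ 2) ^ n * (coeff n (1 - mk bernoulliEven) : ℚ) / 2 := by
  rw [zetaEven, map_sub, coeff_mk, coeff_one]
  split_ifs with h
  · rw [h, bernoulliEven_zero]
    simp
  · rw [zetaNat_two_mul h]
    push_cast
    ring

/-- The evaluation of `ζ⋆({2}ⁿ)` in terms of Bernoulli numbers. -/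
theorem zetaStarTwos_eq (n : ℕ) :
    zetaStarTwos n = (-(2 * Real.pi) ^ 2) ^ n * bernoulliHalf n := by
  induction n using Nat.strong_induction_on with
  | _ n ih =>
    rcases Nat.eq_zero_or_pos n with rfl | hn
    · rw [bernoulliHalf_zero, zetaStarTwos, twos_zero]
      simp
    · have h1 := congrArg (fun q : ℚ => (q : ℝ)) (coeff_bernoulliHalf_mul n)
      have h2 := zetaStarTwos_newton n
      have h3 : ∀ p ∈ Finset.HasAntidiagonal.antidiagonal n, zetaStarTwos p.1 * zetaEven p.2 =
          (-(2 * Real.pi) ^ 2) ^ n / 2 * ((bernoulliHalf p.1 *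
            PowerSeries.coeff p.2 (1 - PowerSeries.mk bernoulliEven) : ℚ) : ℝ) := by
        intro p hp
        rw [Finset.HasAntidiagonal.mem_antidiagonal] at hp
        -- The pair (n, 0) is outside the induction hypothesis, but its term vanishes on both sides.
        by_cases hp2 : p.2 = 0
        · rw [hp2, zetaEven, if_pos rfl, map_sub, PowerSeries.coeff_mk, bernoulliEven_zero]
          simp
        · rw [ih p.1 (by omega), zetaEven_eq, ← hp, pow_add]
          push_cast
          ring
      simp only [PowerSeries.coeff_mul, PowerSeries.coeff_mk] at h1
      rw [Finset.sum_congr rfl h3, ← Finset.mul_sum, ← Rat.cast_sum, h1] at h2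
      have hn' : (n : ℝ) ≠ 0 := by positivity
      refine mul_left_cancel₀ hn' ?_
      rw [h2]
      push_cast
      ring

section

open PowerSeries

theorem X_mul_derivative_zetaStarTwos :
    X * d⁄dX ℝ (mk zetaStarTwos) = mk zetaStarTwos * mk zetaEven := by
  ext n
  rw [coeff_X_mul_derivative, coeff_mk, zetaStarTwos_newton, coeff_mul]
  simp only [coeff_mk]

/-- Euler's convolution identity for the even zeta values. -/
theorem two_mul_zetaEven_sq :
    2 * mk zetaEven ^ 2 = mk zetaEven + 2 * (X * d⁄dX ℝ (mk zetaEven)) - C (3 * zetaEven 1) * X := by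
  ext n
  rw [show (2 : ℝ⟦X⟧) = C 2 from (map_ofNat _ 2).symm, map_sub, map_add, coeff_C_mul, coeff_C_mul,
    coeff_C_mul, coeff_X_mul_derivative, coeff_X, coeff_mk, sq, coeff_mul]
  simp only [coeff_mk]
  -- At n = 1 the convolution is zero and the linear correction cancels 3ζ(2).
  by_cases hn : n = 1
  · subst hn
    rw [Finset.Nat.sum_antidiagonal_succ]
    simp [zetaEven]
    ring
  · have h3 : ∀ p ∈ Finset.HasAntidiagonal.antidiagonal n, zetaEven p.1 * zetaEven p.2 =
          (-(2 * Real.pi) ^ 2) ^ n / 4 * ((coeff p.1 (1 - mk bernoulliEven) *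
            coeff p.2 (1 - mk bernoulliEven) : ℚ) : ℝ) := by
      intro p hp
      rw [Finset.HasAntidiagonal.mem_antidiagonal] at hp
      rw [zetaEven_eq, zetaEven_eq, ← hp, pow_add]
      push_cast
      ring
    rw [Finset.sum_congr rfl h3, ← Finset.mul_sum, ← Rat.cast_sum, ← coeff_mul, if_neg hn,
      zetaEven_eq]
    have h4 : coeff n ((1 - mk bernoulliEven) * (1 - mk bernoulliEven) : ℚ⟦X⟧) =
        (1 + 2 * n) * coeff n (1 - mk bernoulliEven : ℚ⟦X⟧) := by
      have h5 : ((1 - mk bernoulliEven) * (1 - mk bernoulliEven) : ℚ⟦X⟧)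
          = 1 - C 2 * mk bernoulliEven + mk bernoulliEven * mk bernoulliEven := by
        rw [map_ofNat]
        ring
      rw [h5, map_add, map_sub, map_sub, coeff_C_mul, coeff_bernoulliEven_sq hn, coeff_mk, coeff_one]
      split_ifs with h
      · rw [h, Nat.cast_zero]
        ring
      · ring
    rw [h4]
    push_cast
    ring

/-- Write θ = X d/dX. Newton's identity θZ = ZE gives θ²Z = Z(E² + θE), and Euler's formula replaces
2E² in 2(θ² - θ)Z by terms linear in E. -/
theorem coeff_zetaStarTwos_second_order (n : ℕ) :
    2 * ((n : ℝ) ^ 2 - n) * zetaStarTwos n = coeff n (mk zetaStarTwos *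
      (4 * (X * d⁄dX ℝ (mk zetaEven)) - mk zetaEven - C (3 * zetaEven 1) * X)) := by
  have h1 := X_mul_derivative_zetaStarTwos
  have h2 := congrArg (fun f => X * d⁄dX ℝ f) h1
  rw [Derivation.leibniz (d⁄dX ℝ) (mk zetaStarTwos), smul_eq_mul, smul_eq_mul] at h2
  have h3 : mk zetaStarTwos *
      (4 * (X * d⁄dX ℝ (mk zetaEven)) - mk zetaEven - C (3 * zetaEven 1) * X) =
      C 2 * (X * d⁄dX ℝ (X * d⁄dX ℝ (mk zetaStarTwos)) - X * d⁄dX ℝ (mk zetaStarTwos)) := by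
    rw [h2, map_ofNat]
    linear_combination (-2 * mk zetaEven + 2) * h1 - mk zetaStarTwos * two_mul_zetaEven_sq
  rw [h3, coeff_C_mul, map_sub, coeff_X_mul_derivative, coeff_X_mul_derivative, coeff_mk]
  ring

end

/-- The terms with ζ(2) cancel since 4 - 1 - 3 = 0, so the sum starts at ζ(4); 4(b + 2) - 1 gives
the weight 4b + 7. -/
theorem second_order_newton (n : ℕ) :
    2 * ((n : ℝ) + 2) * (n + 1) * zetaStarTwos (n + 2) =
      ∑ p ∈ Finset.HasAntidiagonal.antidiagonal n,
        zetaStarTwos p.1 * ((4 * p.2 + 7) * zetaEven (p.2 + 2)) := by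
  have h := coeff_zetaStarTwos_second_order (n + 2)
  rw [PowerSeries.coeff_mul, Finset.Nat.sum_antidiagonal_succ', Finset.Nat.sum_antidiagonal_succ'] at h
  simp only [map_sub, PowerSeries.coeff_mk, PowerSeries.coeff_C_mul, PowerSeries.coeff_X,
    show (4 : PowerSeries ℝ) = PowerSeries.C 4 from (map_ofNat _ 4).symm,
    coeff_X_mul_derivative] at h
  have h0 : zetaEven 0 = 0 := if_pos rfl
  rw [h0] at h
  norm_num at h
  have h1 : zetaStarTwos (n + 1) * (4 * zetaEven 1 - zetaEven 1 - 3 * zetaEven 1) = 0 := by ring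
  rw [h1, zero_add] at h
  rw [show 2 * ((n : ℝ) + 2) * (n + 1) * zetaStarTwos (n + 2)
    = 2 * (((n : ℝ) + 2) ^ 2 - (n + 2)) * zetaStarTwos (n + 2) by ring, h]
  refine Finset.sum_congr rfl fun p _ => ?_
  ring

/-! ### The coefficient c(s) -/

theorem bernoulli_quotient_mul {M i : ℕ} (hi : i ≤ M) :
    ((2 * M).choose (2 * i) : ℚ) *
        (bernoulli (2 * (M - i)) * bernoulli (2 * i) / bernoulli (2 * M)) *
        ((1 - (2 : ℚ) ^ (1 - 2 * ((M : ℤ) - (i : ℤ)))) / (1 - (2 : ℚ) ^ (1 - 2 * (M : ℤ)))) *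
      bernoulliHalf M = bernoulliEven i * bernoulliHalf (M - i) := by
  have hz : ∀ m : ℕ, (2 : ℚ) ^ (1 - 2 * (m : ℤ)) = 2 / 4 ^ m := fun m => by
    rw [zpow_sub₀ two_ne_zero, zpow_one, zpow_mul, zpow_natCast]
    norm_num
  -- Positivity of ζ⋆({2}^M) shows that neither B_{2M} nor 1 - 2^{1-2M} vanishes.
  have hM : bernoulliHalf M ≠ 0 := by
    intro h
    have := zetaStarTwos_eq M
    rw [h, Rat.cast_zero, mul_zero] at this
    exact (zetaStarTwos_pos M).ne' this
  rw [← Nat.cast_sub hi, hz, hz]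
  have hc : ((2 * M).choose (2 * i) : ℚ)
      = (2 * M).factorial / ((2 * i).factorial * (2 * (M - i)).factorial) := by
    rw [Nat.cast_choose ℚ (by omega), Nat.mul_sub]
  rw [hc]
  simp only [bernoulliHalf, bernoulliEven] at hM ⊢
  have h1 : (2 / 4 ^ M - 1 : ℚ) ≠ 0 := left_ne_zero_of_mul hM
  have h2 : bernoulli (2 * M) ≠ 0 := fun h => by simp [h] at hM
  have h3 : (1 - 2 / 4 ^ M : ℚ) ≠ 0 := fun h => h1 (by linarith)
  have e : (2 / 4 ^ M - 1 : ℚ) = -(1 - 2 / 4 ^ M) := by ring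
  have e' : (2 / 4 ^ (M - i) - 1 : ℚ) = -(1 - 2 / 4 ^ (M - i)) := by ring
  rw [e, e']
  generalize (1 - 2 / 4 ^ M : ℚ) = u at *
  generalize (1 - 2 / 4 ^ (M - i) : ℚ) = w at *
  have f1 : ((2 * M).factorial : ℚ) ≠ 0 := by positivity
  have f2 : ((2 * i).factorial : ℚ) ≠ 0 := by positivity
  have f3 : ((2 * (M - i)).factorial : ℚ) ≠ 0 := by positivity
  field_simp

theorem sum_Icc_two_eq_sum_antidiagonal (f : ℕ → ℕ → ℝ) (n : ℕ) :
    ∑ i ∈ Finset.Icc 2 (n + 2), f (n + 2 - i) i =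
      ∑ p ∈ Finset.HasAntidiagonal.antidiagonal n, f p.1 (p.2 + 2) := by
  rw [← Finset.Nat.sum_antidiagonal_swap,
    Finset.Nat.sum_antidiagonal_eq_sum_range_succ_mk]
  have : Finset.Icc 2 (n + 2) = Finset.Ico 2 (n + 3) := by
    ext i
    simp only [Finset.mem_Icc, Finset.mem_Ico]
    omega
  rw [this, Finset.sum_Ico_eq_sum_range]
  refine Finset.sum_congr rfl fun i hi => ?_
  simp only [Prod.swap]
  rw [show n + 2 - (2 + i) = n - i by omega, add_comm 2 i]

/-- The polynomial part of c(s) yields the weights 4b + 7, the Bernoulli sum yields -4, and together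
they make 4b + 3. -/
theorem three_mul_cCoeff (n : ℕ) :
    3 * ((cCoeff (n + 1) : ℝ) * zetaStarTwos (n + 2)) =
      ∑ p ∈ Finset.HasAntidiagonal.antidiagonal n,
        zetaStarTwos p.1 * ((4 * (p.2 : ℝ) + 3) * zetaNat (2 * p.2 + 4)) := by
  have hz : ∀ j, zetaNat (2 * j + 4) = zetaEven (j + 2) := fun j => by
    rw [zetaEven, if_neg (by omega)]
    ring_nf
  have h1 : ∀ i ∈ Finset.Icc 2 (n + 2),
      (((2 * (n + 2)).choose (2 * i) *
        (bernoulli (2 * (n + 2 - i)) * bernoulli (2 * i) / bernoulli (2 * (n + 2))) *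
        ((1 - (2 : ℚ) ^ (1 - 2 * (((n + 2 : ℕ) : ℤ) - (i : ℤ)))) /
          (1 - (2 : ℚ) ^ (1 - 2 * ((n + 2 : ℕ) : ℤ)))) : ℚ) : ℝ) * zetaStarTwos (n + 2)
      = zetaStarTwos (n + 2 - i) * (-2 * zetaEven i) := by
    intro i hi
    rw [Finset.mem_Icc] at hi
    have hq := congrArg (fun q : ℚ => (q : ℝ)) (bernoulli_quotient_mul hi.2)
    simp only [Rat.cast_mul _ (bernoulliHalf _)] at hq
    rw [zetaStarTwos_eq, zetaStarTwos_eq, mul_left_comm, hq, zetaEven, if_neg (by omega),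
      zetaNat_two_mul (by omega)]
    have : (-(2 * Real.pi) ^ 2) ^ (n + 2)
        = (-(2 * Real.pi) ^ 2) ^ (n + 2 - i) * (-(2 * Real.pi) ^ 2) ^ i := by
      rw [← pow_add, Nat.sub_add_cancel hi.2]
    rw [this]
    ring
  have h2 : cCoeff (n + 1) = 2 * ((n : ℚ) + 1) * (n + 2) / 3 + 2 / 3 *
      ∑ i ∈ Finset.Icc 2 (n + 2), ((2 * (n + 2)).choose (2 * i) *
        (bernoulli (2 * (n + 2 - i)) * bernoulli (2 * i) / bernoulli (2 * (n + 2))) *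
        ((1 - (2 : ℚ) ^ (1 - 2 * (((n + 2 : ℕ) : ℤ) - (i : ℤ)))) /
          (1 - (2 : ℚ) ^ (1 - 2 * ((n + 2 : ℕ) : ℤ))))) := by
    have e : (((n + 1 : ℕ) : ℤ) + 1) = ((n + 2 : ℕ) : ℤ) := by push_cast; ring
    rw [cCoeff, e]
    push_cast
    ring
  have h3 : ((cCoeff (n + 1) : ℚ) : ℝ) * zetaStarTwos (n + 2) =
      2 * ((n : ℝ) + 1) * (n + 2) / 3 * zetaStarTwos (n + 2) + 2 / 3 *
        ∑ p ∈ Finset.HasAntidiagonal.antidiagonal n,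
          zetaStarTwos p.1 * (-2 * zetaEven (p.2 + 2)) := by
    rw [← sum_Icc_two_eq_sum_antidiagonal (fun a b => zetaStarTwos a * (-2 * zetaEven b)),
      ← Finset.sum_congr rfl h1, ← Finset.sum_mul, ← Rat.cast_sum, h2]
    simp only [Rat.cast_add, Rat.cast_mul (2 / 3)]
    push_cast
    ring
  have h4 := second_order_newton n
  have h5 : ∑ p ∈ Finset.HasAntidiagonal.antidiagonal n,
        zetaStarTwos p.1 * ((4 * (p.2 : ℝ) + 3) * zetaNat (2 * p.2 + 4)) =
      ∑ p ∈ Finset.HasAntidiagonal.antidiagonal n,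
        zetaStarTwos p.1 * ((4 * p.2 + 7) * zetaEven (p.2 + 2))
      + 2 * ∑ p ∈ Finset.HasAntidiagonal.antidiagonal n,
          zetaStarTwos p.1 * (-2 * zetaEven (p.2 + 2)) := by
    rw [Finset.mul_sum, ← Finset.sum_add_distrib]
    refine Finset.sum_congr rfl fun p _ => ?_
    rw [hz]
    ring
  rw [h5, ← h4, h3]
  ring

/-! ### Reindexing the triples and conclusion -/

theorem sum_triples (f : ℕ → ℕ → ℕ → ℝ) (n : ℕ) :
    ∑ k ∈ triples (n + 2), f k.1 k.2.1 k.2.2 =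
      ∑ p ∈ Finset.HasAntidiagonal.antidiagonal n,
        ∑ q ∈ Finset.HasAntidiagonal.antidiagonal p.2, f p.1 q.1 q.2 := by
  rw [Finset.sum_sigma']
  refine Finset.sum_nbij' (fun k => ⟨(k.1, k.2.1 + k.2.2), k.2⟩) (fun s => (s.1.1, s.2))
    (fun k hk => ?_) (fun s hs => ?_) (fun k _ => rfl) (fun s hs => ?_) (fun k _ => rfl)
  · simp only [triples, Finset.mem_filter, Finset.mem_product, Finset.mem_range] at hk
    simp only [Finset.mem_sigma, Finset.HasAntidiagonal.mem_antidiagonal, and_true]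
    omega
  · simp only [Finset.mem_sigma, Finset.HasAntidiagonal.mem_antidiagonal] at hs
    simp only [triples, Finset.mem_filter, Finset.mem_product, Finset.mem_range]
    omega
  · obtain ⟨⟨a, b⟩, c, d⟩ := s
    simp only [Finset.mem_sigma, Finset.HasAntidiagonal.mem_antidiagonal] at hs
    obtain ⟨-, rfl⟩ := hs
    rfl

theorem starTail_twoThree_ne_top (a b c : ℕ) : starTail (twoThree a b c) 1 ≠ ⊤ :=
  starTail_ne_top _ (fun _ => two_le_of_mem_twoThree) 1 le_rfl

theorem toReal_twoThrees (n : ℕ) : (twoThrees n 1).toReal =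
    ∑ p ∈ Finset.HasAntidiagonal.antidiagonal n,
      ∑ q ∈ Finset.HasAntidiagonal.antidiagonal p.2, zetaStar (twoThree p.1 q.1 q.2) := by
  rw [twoThrees_eq, ENNReal.toReal_sum fun p _ => ENNReal.sum_ne_top.2 fun q _ =>
    starTail_twoThree_ne_top _ _ _]
  refine Finset.sum_congr rfl fun p _ => ?_
  rw [ENNReal.toReal_sum fun q _ => starTail_twoThree_ne_top _ _ _]
  exact Finset.sum_congr rfl fun q _ => (zetaStar_eq_toReal _).symm

theorem toReal_prependArg_oneThree (n : ℕ) : (prependArg 3 (oneThree n) 1).toReal =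
    ∑ q ∈ Finset.HasAntidiagonal.antidiagonal n, zetaStar (twoThree 0 q.1 q.2) := by
  rw [prependArg_oneThree, ENNReal.toReal_sum fun q _ => starTail_twoThree_ne_top _ _ _]
  exact Finset.sum_congr rfl fun q _ => (zetaStar_eq_toReal _).symm

/-- Every string is counted twice through `twoThrees`, and those with k₁ = 0 once more through
`prependArg 3 (oneThree n)`. The shift is the factor x, which also makes the sum empty for s = 1. -/
theorem sum_triples_zetaStar (n : ℕ) :
    ∑ k ∈ triples (n + 1), (2 + if k.1 = 0 then (1 : ℝ) else 0) *
        zetaStar (twoThree k.1 k.2.1 k.2.2) =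
      shiftCoeff (fun n =>
        (prependArg 3 (oneThree n) 1).toReal + 2 * (twoThrees n 1).toReal) n := by
  cases n with
  | zero =>
    rw [shiftCoeff]
    refine Finset.sum_eq_zero fun k hk => ?_
    simp only [triples, Finset.mem_filter] at hk
    omega
  | succ n =>
    rw [shiftCoeff, sum_triples (fun a b c => (2 + if a = 0 then (1 : ℝ) else 0) *
      zetaStar (twoThree a b c)), toReal_twoThrees, toReal_prependArg_oneThree]
    simp only [add_mul, Finset.sum_add_distrib, ← Finset.mul_sum]
    rw [add_comm]
    congr 1
    rw [Finset.sum_eq_single (0, n)]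
    · simp
    · rintro ⟨a, b⟩ hp hne
      rw [Finset.HasAntidiagonal.mem_antidiagonal] at hp
      have : a ≠ 0 := by
        rintro rfl
        exact hne (by rw [← hp, zero_add])
      simp [this]
    · intro h
      exact absurd (Finset.HasAntidiagonal.mem_antidiagonal.2 (zero_add n)) h

theorem theorem3 (s : ℕ) (hs : 1 ≤ s) :
    ZetaStarConverges (4 :: List.replicate (s - 1) 2) ∧
    ZetaStarConverges (List.replicate (s + 1) 2) ∧
    (∀ k ∈ triples s, ZetaStarConverges (twoThree k.1 k.2.1 k.2.2)) ∧
    zetaStar (4 :: List.replicate (s - 1) 2) =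
      (cCoeff s : ℝ) * zetaStar (List.replicate (s + 1) 2) -
        2 / 3 * ∑ k ∈ triples s,
          (2 + if k.1 = 0 then (1 : ℝ) else 0) * zetaStar (twoThree k.1 k.2.1 k.2.2) := by
  obtain ⟨n, rfl⟩ : ∃ n, s = n + 1 := ⟨s - 1, by omega⟩
  rw [Nat.add_sub_cancel]
  refine ⟨zetaStarConverges_of_ne_top (starTail_ne_top _ (fun j hj => ?_) 1 le_rfl),
    zetaStarConverges_of_ne_top (starTail_ne_top _ (fun j hj => ?_) 1 le_rfl),
    fun k _ => zetaStarConverges_of_ne_top (starTail_twoThree_ne_top _ _ _), ?_⟩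
  · simp only [List.mem_cons, List.mem_replicate] at hj
    omega
  · exact (List.eq_of_mem_replicate hj).ge
  · have h1 := three_mul_zetaStar_four_twos n
    rw [← three_mul_cCoeff, ← sum_triples_zetaStar] at h1
    have h2 : zetaStar (4 :: List.replicate n 2) = (prependArg 4 (twos n) 1).toReal := by
      rw [zetaStar_eq_toReal, starTail_cons]
      rfl
    have h3 : zetaStar (List.replicate (n + 1 + 1) 2) = zetaStarTwos (n + 2) :=
      zetaStar_eq_toReal _
    rw [h2, h3]
    linarith
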